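/- Consider an open system of $N\ge 1$ agents with labels $1,\dots,N$ on the time interval $[0,\infty)$. The label $i$ carries the piecewise constant value $x_i(t)$: an initial value is drawn at time $0$, and a new value is drawn each time agent $i$ is replaced. All the values drawn are i.i.d. real random variables with mean $0$ and finite variance $\sigma^2$. The replacements of agent $i$ occur at the ticks of a Poisson clock of rate $\lambda_r>0$. Agent $i$ performs "Ping updates" at the ticks of a Poisson clock of rate $\lambda_p>0$. The replacement clocks of the different agents are mutually independent; the family of the values, the family of the replacement clocks and the family of the Ping clocks are mutually independent. The Ping clocks of different agents may depend on each other in any way. The knowledge set $K_i(t)$ of agent $i$ evolves as follows (Ping model). At time $0$ it is $\{(x_i(0),i,0)\}$. When agent $i$ is replaced at time $u$, the memory is inherited and the new value is recorded: $K_i(u^+)=K_i(u^-)\cup\{(x_i(u),i,u)\}$. When agent $i$ performs a Ping update at time $u$, it receives information from every other agent: $$K_i(u^+)=K_i(u^-)\cup\bigcup_{j\ne i}\Big(K_j(u^-)\cup\{(x_j(u),j,u)\}\cup\{(j\to i,u)\}\Big),$$ where $(j\to i,u)$ records the information exchange. Between these events $K_i$ is constant. An algorithm implementable on the knowledge sets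 gives, for every agent $i$ and every time $t$, an estimate $y_i(t)$ that is a (measurable) function of $K_i(t)$; the function may be any one, and may depend on $i$, $t$, $N$, $\lambda_r$, $\lambda_p$ and the law of the values. Let $$\bar x(t)=\frac1N\sum_{i=1}^N x_i(t),\qquad C(t)=\frac1N\sum_{i=1}^N\big(\bar x(t)-y_i(t)\big)^2 .$$ Then, for every such algorithm, $$\liminf_{t\to\infty}\mathbb E[C(t)]\;\ge\;\frac{N-1}{N^2}\cdot\frac{1}{1+\frac{\lambda_p}{2\lambda_r}}\cdot\sigma^2,$$ where $\mathbb E[C(t)]\in[0,\infty]$. -/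

import Mathlib

open MeasureTheory ProbabilityTheory Filter
open scoped NNReal ENNReal

noncomputable section

namespace PingModel

/-- A Poisson clock of the given rate, represented by its counting process: `Z t` is the number of
ticks in `(0, t]`. The paths are nondecreasing, right-continuous and start at `0`; the increments
are independent and Poisson distributed. -/
structure IsPoissonClock {Ω : Type*} [MeasurableSpace Ω] (μ : Measure Ω) (rate : ℝ≥0)
    (Z : ℝ≥0 → Ω → ℕ) : Prop where
  measurable : ∀ t, Measurable (Z t)
  zero : ∀ ω, Z 0 ω = 0
  mono : ∀ ω, Monotone fun t => Z t ω
  right_continuous : ∀ ω t, ContinuousWithinAt (fun s => Z s ω) (Set.Ici t) t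
  indep_increments : HasIndepIncrements Z μ
  law_increment : ∀ s t, s ≤ t →
    HasLaw (fun ω => Z t ω - Z s ω) (poissonMeasure (rate * (t - s))) μ

/-- The set of ticks (jump times) of a counting path. -/
def tickTimes (z : ℝ≥0 → ℕ) : Set ℝ≥0 := {t | 0 < t ∧ ∀ s < t, z s < z t}

/-- A piece of information in a system of `N` agents. `Sum.inl (v, j, s)` says that the value of
agent `j` at time `s` is `v`; `Sum.inr (j, i, s)` says that `j` sent information to `i` at
time `s`. -/
abbrev Info (N : ℕ) : Type := (ℝ × Fin N × ℝ≥0) ⊕ (Fin N × Fin N × ℝ≥0)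

/-- `Knows x repl exch i t a`: the piece of information `a` belongs to the knowledge set of agent
`i` at time `t` (just after the events of time `t`, if any), when replacements inherit the memory
of the replaced agent. Here `x j s` is the value of agent `j` at time `s`, `repl j` is the set of
replacement times of agent `j`, and `exch j i` is the set of times at which `j` sends information
to `i`. An agent knows its own value at time `0` and at its replacements. When `j` sends information
to `i` at time `u`, agent `i` gets the current value of `j`, the fact that the exchange took place,
and all that `j` knew just before `u`. Nothing is ever forgotten. -/
inductive Knows {N : ℕ} (x : Fin N → ℝ≥0 → ℝ) (repl : Fin N → Set ℝ≥0)
    (exch : Fin N → Fin N → Set ℝ≥0) : Fin N → ℝ≥0 → Info N → Prop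
  | initial (i : Fin N) (t : ℝ≥0) : Knows x repl exch i t (Sum.inl (x i 0, i, 0))
  | replaced {i : Fin N} {u t : ℝ≥0} (hu : u ∈ repl i) (hut : u ≤ t) :
      Knows x repl exch i t (Sum.inl (x i u, i, u))
  | observed {i j : Fin N} {u t : ℝ≥0} (hu : u ∈ exch j i) (hut : u ≤ t) :
      Knows x repl exch i t (Sum.inl (x j u, j, u))
  | recorded {i j : Fin N} {u t : ℝ≥0} (hu : u ∈ exch j i) (hut : u ≤ t) :
      Knows x repl exch i t (Sum.inr (j, i, u))
  | received {i j : Fin N} {u v t : ℝ≥0} {a : Info N} (hu : u ∈ exch j i) (hut : u ≤ t)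
      (hvu : v < u) (ha : Knows x repl exch j v a) : Knows x repl exch i t a

/-- The σ-algebra on knowledge sets generated by the events that the knowledge set contains a
piece of information from `B`, for `B` a Borel set of pieces of information. (As the space of pieces
of information is standard Borel, this is the σ-algebra that makes the number of elements in each
such `B` measurable, as usual for random configurations of points.) -/
@[reducible]
def knowledgeSigma (N : ℕ) : MeasurableSpace (Set (Info N)) :=
  MeasurableSpace.generateFrom
    {A | ∃ B : Set (Info N), MeasurableSet B ∧ A = {K | (K ∩ B).Nonempty}}

/-- The open system with `N` agents and Ping updates. `R i` counts the replacements of agent `i`,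
`P i` counts its Ping updates, and `X i k` is the value given to label `i` at its `k`-th arrival
(`k = 0` being the initialization). Nothing is assumed on the dependence between the Ping clocks of
different agents. -/
structure IsPingSystem {Ω : Type*} [MeasurableSpace Ω] (μ : Measure Ω) (N : ℕ)
    (rateR rateP : ℝ≥0) (σ : ℝ) (ν : Measure ℝ) (R P : Fin N → ℝ≥0 → Ω → ℕ)
    (X : Fin N → ℕ → Ω → ℝ) : Prop where
  replacement_clock : ∀ i, IsPoissonClock μ rateR (R i)
  ping_clock : ∀ i, IsPoissonClock μ rateP (P i)
  measurable_value : ∀ i k, Measurable (X i k)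
  law_value : ∀ i k, HasLaw (X i k) ν μ
  memLp_value : MemLp (fun v : ℝ => v) 2 ν
  mean_value : ∫ v, v ∂ν = 0
  variance_value : ∫ v, v ^ 2 ∂ν = σ ^ 2
  values_indep : iIndepFun (fun (p : Fin N × ℕ) ω => X p.1 p.2 ω) μ
  replacements_indep : iIndepFun (fun (i : Fin N) ω (t : ℝ≥0) => R i t ω) μ
  replacements_indep_values :
    IndepFun (fun ω (i : Fin N) (t : ℝ≥0) => R i t ω) (fun ω (i : Fin N) (k : ℕ) => X i k ω) μ
  pings_indep :
    IndepFun (fun ω (i : Fin N) (t : ℝ≥0) => P i t ω)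
      (fun ω => ((fun (i : Fin N) (t : ℝ≥0) => R i t ω), (fun (i : Fin N) (k : ℕ) => X i k ω))) μ

section System

variable {Ω : Type*} {N : ℕ}

/-- The value `x_i(t)` held by agent `i` at time `t`. -/
def value (R : Fin N → ℝ≥0 → Ω → ℕ) (X : Fin N → ℕ → Ω → ℝ) (i : Fin N) (t : ℝ≥0) (ω : Ω) : ℝ :=
  X i (R i t ω) ω

/-- The average of the values held by the agents at time `t`. -/
def average (R : Fin N → ℝ≥0 → Ω → ℕ) (X : Fin N → ℕ → Ω → ℝ) (t : ℝ≥0) (ω : Ω) : ℝ :=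
  1 / (N : ℝ) * ∑ i, value R X i t ω

/-- The knowledge set of agent `i` at time `t` in the Ping model: at each tick of its Ping clock,
agent `i` receives information from all the other agents. -/
def pingKnowledge (R P : Fin N → ℝ≥0 → Ω → ℕ) (X : Fin N → ℕ → Ω → ℝ) (i : Fin N) (t : ℝ≥0)
    (ω : Ω) : Set (Info N) :=
  {a | Knows (fun j s => value R X j s ω) (fun j => tickTimes fun s => R j s ω)
    (fun j k => {u | j ≠ k ∧ u ∈ tickTimes fun s => P k s ω}) i t a}

/-- The mean squared error `C(t)` of the algorithm in which the estimate of agent `i` at time `t` is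
`y i t` evaluated at its knowledge set. -/
def squaredError (R P : Fin N → ℝ≥0 → Ω → ℕ) (X : Fin N → ℕ → Ω → ℝ)
    (y : Fin N → ℝ≥0 → Set (Info N) → ℝ) (t : ℝ≥0) (ω : Ω) : ℝ :=
  1 / (N : ℝ) * ∑ i, (average R X t ω - y i t (pingKnowledge R P X i t ω)) ^ 2

end System

end PingModel

end

/-! Fix an agent `i`, a time `t`, and `q ≤ t` such that `i` performs no Ping in `(q, t]`. What `i`
knows at `t` is then determined by the system up to `q` and by its own values and replacements
(`Knows.of_agree`, `pingKnowledge_stopAt`). For `j ≠ i` let `p = exp (-λ_r (t - q))`, the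
probability that `j` is not replaced in `(q, t]`. The best prediction of `x_j(t)` from the past is
`p x_j(q)`; the fresh part `x_j(t) - p x_j(q)` is centered given that past and has variance `(1 -
p²) σ²`. It is orthogonal to every variable that ignores the replacements of `j` after `q` and its
later values, so its variance simply adds to the mean square of such a variable
(`IsPingSystem.setLIntegral_fresh`).

The error `N (x̄(t) - y_i(t))` is the sum of `N - 1` fresh parts and a remainder. Peeling them off
one agent at a time (`IsPingSystem.le_setLIntegral_sum_fresh`) and dropping the remainder bounds the
squared error of `i` from below by `(N - 1)/N² (1 - p²) σ²`. This holds on any event of the Ping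
clocks on which `i` receives nothing in `(q, t]`.

It remains to average over the age `T` of the last Ping of `i`, which for large `t` is nearly
exponential of rate `λ_p`: `E[1 - exp (-2 λ_r T)] = 2 λ_r / (2 λ_r + λ_p)`, the announced factor.
Each agent is treated separately, so the joint law of the Ping clocks plays no role. The age is
rounded down to a grid of step `δ` (`IsPingSystem.le_lintegral_error`), and `δ → 0` comes last. All
expectations are integrals in `[0, ∞]`, so the estimates need not be square integrable. -/

noncomputable section

namespace PingModel

/-! ### Counting paths and their hitting times -/

/-- A nondecreasing, right-continuous path in `ℕ` starting at `0`. -/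
structure IsCountingPath (z : ℝ≥0 → ℕ) : Prop where
  zero : z 0 = 0
  mono : Monotone z
  right_continuous : ∀ t, ContinuousWithinAt z (Set.Ici t) t

lemma IsPoissonClock.isCountingPath {Ω : Type*} [MeasurableSpace Ω] {μ : Measure Ω} {rate : ℝ≥0}
    {Z : ℝ≥0 → Ω → ℕ} (hZ : IsPoissonClock μ rate Z) (ω : Ω) : IsCountingPath fun t => Z t ω :=
  ⟨hZ.zero ω, hZ.mono ω, hZ.right_continuous ω⟩

/-- The first time at which the path is at least `k`. -/
def hitTime (z : ℝ≥0 → ℕ) (k : ℕ) : ℝ≥0∞ := ⨅ (t : ℝ≥0) (_ : k ≤ z t), (t : ℝ≥0∞)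

/-- Right-continuity with discrete values makes the path constant on some `[t, u)`, so a level not
reached at `t` is not reached before `u`: the infimum is attained. -/
lemma IsCountingPath.hitTime_le_iff {z : ℝ≥0 → ℕ} (hz : IsCountingPath z) {k : ℕ} {t : ℝ≥0} :
    hitTime z k ≤ t ↔ k ≤ z t := by
  refine ⟨fun h => ?_, fun h => iInf₂_le t h⟩
  by_contra! hk
  have h1 : z ⁻¹' {z t} ∈ nhdsWithin t (Set.Ici t) :=
    hz.right_continuous t (by simp [nhds_discrete])
  obtain ⟨u, hu, hsub⟩ := (mem_nhdsGE_iff_exists_Ico_subset).1 h1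
  have h2 : (u : ℝ≥0∞) ≤ hitTime z k := by
    refine le_iInf₂ fun s hs => ?_
    norm_cast
    by_contra! hsu
    rcases le_total s t with hst | hst
    · exact absurd (hs.trans (hz.mono hst)) (not_le.2 hk)
    · have : z s = z t := hsub ⟨hst, hsu⟩
      omega
  have := h2.trans h
  norm_cast at this
  exact absurd this (not_le.2 hu)

/-- Enumerates the ticks by a countable family of random times, which is what measurability needs.
Level `0` is excluded because it is hit at time `0`, which is not a tick. -/
lemma IsCountingPath.mem_tickTimes_iff {z : ℝ≥0 → ℕ} (hz : IsCountingPath z) {u : ℝ≥0} :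
    u ∈ tickTimes z ↔ ∃ k, 1 ≤ k ∧ hitTime z k = u := by
  constructor
  · rintro ⟨hu, h⟩
    refine ⟨z u, by have := h 0 hu; omega, le_antisymm (hz.hitTime_le_iff.2 le_rfl) ?_⟩
    refine le_iInf₂ fun s hs => ?_
    norm_cast
    by_contra! hsu
    exact absurd (h s hsu) (not_lt.2 hs)
  · rintro ⟨k, hk, hu⟩
    have hku : k ≤ z u := hz.hitTime_le_iff.1 hu.le
    refine ⟨pos_iff_ne_zero.2 ?_, fun s hs => ?_⟩
    · rintro rfl
      have := hz.zero
      omega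
    · by_contra! h
      have h2 := hz.hitTime_le_iff.2 (hku.trans h)
      rw [hu] at h2
      norm_cast at h2
      exact absurd h2 (not_le.2 hs)

/-! ### Measurability of the knowledge sets -/

section Measurability

variable {Ω : Type*} {m : MeasurableSpace Ω}

lemma measurable_hitTime {Z : ℝ≥0 → Ω → ℕ} (hpath : ∀ ω, IsCountingPath fun t => Z t ω)
    (hZ : ∀ t, Measurable (Z t)) (k : ℕ) : Measurable fun ω => hitTime (fun t => Z t ω) k := by
  refine measurable_of_Iic fun x => ?_
  induction x with
  | top => simp
  | coe t =>
    have : (fun ω => hitTime (fun t => Z t ω) k) ⁻¹' Set.Iic (t : ℝ≥0∞) = Z t ⁻¹' Set.Ici k := by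
      ext ω
      exact (hpath ω).hitTime_le_iff
    rw [this]
    exact hZ t measurableSet_Ici

lemma measurable_counting_at {Z : ℝ≥0 → Ω → ℕ} (hpath : ∀ ω, IsCountingPath fun t => Z t ω)
    (hZ : ∀ t, Measurable (Z t)) {τ : Ω → ℝ≥0} (hτ : Measurable τ) :
    Measurable fun ω => Z (τ ω) ω := by
  refine measurable_of_Ici fun k => ?_
  have : (fun ω => Z (τ ω) ω) ⁻¹' Set.Ici k
      = {ω | hitTime (fun t => Z t ω) k ≤ (τ ω : ℝ≥0∞)} := by
    ext ω
    exact (hpath ω).hitTime_le_iff.symm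
  rw [this]
  exact measurableSet_le (measurable_hitTime hpath hZ k) hτ.coe_nnreal_ennreal

lemma measurable_index_comp {f : ℕ → Ω → ℝ} (hf : ∀ k, Measurable (f k)) {n : Ω → ℕ}
    (hn : Measurable n) : Measurable fun ω => f (n ω) ω :=
  (measurable_from_prod_countable_right (f := fun p : ℕ × Ω => f p.1 p.2) hf).comp
    (hn.prodMk measurable_id)

variable {N : ℕ} {R P : Fin N → ℝ≥0 → Ω → ℕ} {X : Fin N → ℕ → Ω → ℝ}

lemma measurable_value_at (hRpath : ∀ i ω, IsCountingPath fun t => R i t ω)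
    (hR : ∀ i t, Measurable (R i t)) (hX : ∀ i k, Measurable (X i k)) (i : Fin N) {τ : Ω → ℝ≥0}
    (hτ : Measurable τ) : Measurable fun ω => value R X i (τ ω) ω :=
  measurable_index_comp (hX i) (measurable_counting_at (hRpath i) (hR i) hτ)

/-- The event that agent `i` knows at time `t` a piece of information from `B` which did not go
through any intermediate agent. -/
def directEvent (R P : Fin N → ℝ≥0 → Ω → ℕ) (X : Fin N → ℕ → Ω → ℝ) (B : Set (Info N))
    (i : Fin N) (t : ℝ≥0) : Set Ω :=
  {ω | Sum.inl (value R X i 0 ω, i, 0) ∈ B} ∪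
  (⋃ k ∈ Set.Ici 1, {ω | hitTime (fun s => R i s ω) k ≤ t} ∩
    {ω | Sum.inl (value R X i (hitTime (fun s => R i s ω) k).toNNReal ω, i,
      (hitTime (fun s => R i s ω) k).toNNReal) ∈ B}) ∪
  (⋃ j ∈ {j | j ≠ i}, ⋃ k ∈ Set.Ici 1, {ω | hitTime (fun s => P i s ω) k ≤ t} ∩
    ({ω | Sum.inl (value R X j (hitTime (fun s => P i s ω) k).toNNReal ω, j,
      (hitTime (fun s => P i s ω) k).toNNReal) ∈ B} ∪
     {ω | Sum.inr (j, i, (hitTime (fun s => P i s ω) k).toNNReal) ∈ B}))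

/-- The event that agent `i` knows at time `t` a piece of information from `B` which went through
`n` intermediate agents. -/
def relayedEvent (R P : Fin N → ℝ≥0 → Ω → ℕ) (X : Fin N → ℕ → Ω → ℝ) (B : Set (Info N)) :
    ℕ → Fin N → ℝ≥0 → Set Ω
  | 0, i, t => directEvent R P X B i t
  | n + 1, i, t => ⋃ j ∈ {j | j ≠ i}, ⋃ k ∈ Set.Ici 1, ⋃ l : ℕ,
      {ω | hitTime (fun s => P i s ω) k ≤ t} ∩
      {ω | (TopologicalSpace.denseSeq ℝ≥0 l : ℝ≥0∞) < hitTime (fun s => P i s ω) k} ∩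
      relayedEvent R P X B n j (TopologicalSpace.denseSeq ℝ≥0 l)

lemma measurableSet_directEvent (hRpath : ∀ i ω, IsCountingPath fun t => R i t ω)
    (hPpath : ∀ i ω, IsCountingPath fun t => P i t ω)
    (hR : ∀ i t, Measurable (R i t)) (hP : ∀ i t, Measurable (P i t))
    (hX : ∀ i k, Measurable (X i k)) {B : Set (Info N)} (hB : MeasurableSet B) (i : Fin N)
    (t : ℝ≥0) : MeasurableSet (directEvent R P X B i t) := by
  have hRh := fun i k => measurable_hitTime (hRpath i) (hR i) k
  have hPh := fun i k => measurable_hitTime (hPpath i) (hP i) k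
  have hv : ∀ (i j : Fin N) {τ : Ω → ℝ≥0}, Measurable τ →
      MeasurableSet {ω | (Sum.inl (value R X j (τ ω) ω, j, τ ω) : Info N) ∈ B} := by
    intro i j τ hτ
    exact (measurable_inl.comp ((measurable_value_at hRpath hR hX j hτ).prodMk
      (measurable_const.prodMk hτ))) hB
  refine ((hv i i measurable_const).union (.biUnion (Set.to_countable _) fun k _ => ?_)).union
    (.biUnion (Set.to_countable _) fun j _ => .biUnion (Set.to_countable _) fun k _ => ?_)
  · exact (measurableSet_le (hRh i k) measurable_const).inter
      (hv i i (hRh i k).ennreal_toNNReal)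
  · refine (measurableSet_le (hPh i k) measurable_const).inter
      ((hv i j (hPh i k).ennreal_toNNReal).union ?_)
    exact (measurable_inr.comp (measurable_const.prodMk
      (measurable_const.prodMk (hPh i k).ennreal_toNNReal))) hB

lemma measurableSet_relayedEvent (hRpath : ∀ i ω, IsCountingPath fun t => R i t ω)
    (hPpath : ∀ i ω, IsCountingPath fun t => P i t ω)
    (hR : ∀ i t, Measurable (R i t)) (hP : ∀ i t, Measurable (P i t))
    (hX : ∀ i k, Measurable (X i k)) {B : Set (Info N)} (hB : MeasurableSet B) (n : ℕ) :
    ∀ (i : Fin N) (t : ℝ≥0), MeasurableSet (relayedEvent R P X B n i t) := by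
  induction n with
  | zero => exact fun i t => measurableSet_directEvent hRpath hPpath hR hP hX hB i t
  | succ n ih =>
    intro i t
    have hPh := fun k => measurable_hitTime (hPpath i) (hP i) k
    exact .biUnion (Set.to_countable _) fun j _ => .biUnion (Set.to_countable _) fun k _ =>
      .iUnion fun l => ((measurableSet_le (hPh k) measurable_const).inter
        (measurableSet_lt measurable_const (hPh k))).inter (ih j _)

lemma exists_pingKnowledge_of_mem_relayedEvent (hRpath : ∀ i ω, IsCountingPath fun t => R i t ω)
    (hPpath : ∀ i ω, IsCountingPath fun t => P i t ω) {B : Set (Info N)} {ω : Ω} (n : ℕ) :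
    ∀ (i : Fin N) (t : ℝ≥0), ω ∈ relayedEvent R P X B n i t →
      (pingKnowledge R P X i t ω ∩ B).Nonempty := by
  have hfin : ∀ {a : ℝ≥0∞} {t : ℝ≥0}, a ≤ t → a = a.toNNReal := fun h =>
    (ENNReal.coe_toNNReal (ne_top_of_le_ne_top ENNReal.coe_ne_top h)).symm
  have hle : ∀ {a : ℝ≥0∞} {t : ℝ≥0}, a ≤ t → a.toNNReal ≤ t := fun h => by
    have h' := h
    rw [hfin h] at h'
    exact_mod_cast h'
  induction n with
  | zero =>
    rintro i t ((h | h) | h)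
    · exact ⟨_, .initial i t, h⟩
    · simp only [Set.mem_iUnion] at h
      obtain ⟨k, hk, ht, h⟩ := h
      exact ⟨_, .replaced ((hRpath i ω).mem_tickTimes_iff.2 ⟨k, hk, hfin ht⟩) (hle ht), h⟩
    · simp only [Set.mem_iUnion] at h
      obtain ⟨j, hj, k, hk, ht, h⟩ := h
      have hu := (hPpath i ω).mem_tickTimes_iff.2 ⟨k, hk, hfin ht⟩
      rcases h with h | h
      · exact ⟨_, .observed ⟨hj, hu⟩ (hle ht), h⟩
      · exact ⟨_, .recorded ⟨hj, hu⟩ (hle ht), h⟩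
  | succ n ih =>
    intro i t h
    simp only [relayedEvent, Set.mem_iUnion] at h
    obtain ⟨j, hj, k, hk, l, ⟨ht, hl⟩, h⟩ := h
    have hu := (hPpath i ω).mem_tickTimes_iff.2 ⟨k, hk, hfin ht⟩
    obtain ⟨a, ha, haB⟩ := ih _ _ h
    have hl' : TopologicalSpace.denseSeq ℝ≥0 l < (hitTime (fun s => P i s ω) k).toNNReal := by
      have hl2 : (TopologicalSpace.denseSeq ℝ≥0 l : ℝ≥0∞) < hitTime (fun s => P i s ω) k := hl
      rw [hfin ht] at hl2
      exact_mod_cast hl2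
    exact ⟨a, .received ⟨hj, hu⟩ (hle ht) hl' ha, haB⟩

lemma exists_mem_relayedEvent_of_mem_pingKnowledge
    (hRpath : ∀ i ω, IsCountingPath fun t => R i t ω)
    (hPpath : ∀ i ω, IsCountingPath fun t => P i t ω) {B : Set (Info N)} {ω : Ω} {i : Fin N}
    {t : ℝ≥0} {a : Info N} (ha : a ∈ pingKnowledge R P X i t ω) (haB : a ∈ B) :
    ∃ n, ω ∈ relayedEvent R P X B n i t := by
  -- Monotonicity in time is built into the induction, so that a relay time can later be moved up to
  -- a point of the dense sequence.
  suffices ∀ t', t ≤ t' → ∃ n, ω ∈ relayedEvent R P X B n i t' from this t le_rfl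
  change Knows _ _ _ _ _ _ at ha
  induction ha with
  | initial i t => exact fun t' _ => ⟨0, Or.inl (Or.inl haB)⟩
  | @replaced i u t hu hut =>
    intro t' ht'
    obtain ⟨k, hk, hku⟩ := (hRpath i ω).mem_tickTimes_iff.1 hu
    refine ⟨0, Or.inl (Or.inr ?_)⟩
    simp only [Set.mem_iUnion]
    refine ⟨k, hk, ?_, ?_⟩
    · simpa [hku] using hut.trans ht'
    · simpa [hku] using haB
  | @observed i j u t hu hut =>
    intro t' ht'
    obtain ⟨k, hk, hku⟩ := (hPpath i ω).mem_tickTimes_iff.1 hu.2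
    refine ⟨0, Or.inr ?_⟩
    simp only [Set.mem_iUnion]
    refine ⟨j, hu.1, k, hk, ?_, Or.inl ?_⟩
    · simpa [hku] using hut.trans ht'
    · simpa [hku] using haB
  | @recorded i j u t hu hut =>
    intro t' ht'
    obtain ⟨k, hk, hku⟩ := (hPpath i ω).mem_tickTimes_iff.1 hu.2
    refine ⟨0, Or.inr ?_⟩
    simp only [Set.mem_iUnion]
    refine ⟨j, hu.1, k, hk, ?_, Or.inr ?_⟩
    · simpa [hku] using hut.trans ht'
    · simpa [hku] using haB
  | @received i j u v t a hu hut hvu ha ih =>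
    intro t' ht'
    obtain ⟨k, hk, hku⟩ := (hPpath i ω).mem_tickTimes_iff.1 hu.2
    -- The arbitrary time `v` before the exchange is replaced by one from a countable set; this
    -- turns the existential in `Knows.received` into a countable union.
    obtain ⟨_, ⟨l, rfl⟩, hvl, hlu⟩ :=
      (TopologicalSpace.denseRange_denseSeq ℝ≥0).exists_between hvu
    obtain ⟨n, hn⟩ := ih haB _ hvl.le
    refine ⟨n + 1, ?_⟩
    simp only [relayedEvent, Set.mem_iUnion]
    refine ⟨j, hu.1, k, hk, l, ⟨?_, ?_⟩, hn⟩
    · simpa [hku] using hut.trans ht'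
    · simpa [hku] using hlu

/-- The knowledge set of an agent is measurable for any σ-algebra for which the clocks and the
values are measurable. -/
lemma measurable_pingKnowledge (hRpath : ∀ i ω, IsCountingPath fun t => R i t ω)
    (hPpath : ∀ i ω, IsCountingPath fun t => P i t ω)
    (hR : ∀ i t, Measurable (R i t)) (hP : ∀ i t, Measurable (P i t))
    (hX : ∀ i k, Measurable (X i k)) (i : Fin N) (t : ℝ≥0) :
    Measurable[m, knowledgeSigma N] (pingKnowledge R P X i t) := by
  refine @measurable_generateFrom _ _ m _ _ ?_
  rintro _ ⟨B, hB, rfl⟩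
  have : pingKnowledge R P X i t ⁻¹' {K | (K ∩ B).Nonempty}
      = ⋃ n, relayedEvent R P X B n i t := by
    ext ω
    rw [Set.mem_iUnion]
    exact ⟨fun ⟨a, ha, haB⟩ => exists_mem_relayedEvent_of_mem_pingKnowledge hRpath hPpath ha haB,
      fun ⟨n, hn⟩ => exists_pingKnowledge_of_mem_relayedEvent hRpath hPpath n i t hn⟩
  rw [this]
  exact .iUnion fun n => measurableSet_relayedEvent hRpath hPpath hR hP hX hB n i t

end Measurability

/-! ### Knowledge depends only on the past of the last exchange -/

/-- Causality: times only decrease when a derivation is traced back, so nothing after `q` is ever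
used. -/
lemma Knows.of_agree_le {N : ℕ} {x x' : Fin N → ℝ≥0 → ℝ} {repl repl' : Fin N → Set ℝ≥0}
    {exch exch' : Fin N → Fin N → Set ℝ≥0} {q : ℝ≥0}
    (hx : ∀ j, ∀ s ≤ q, x j s = x' j s) (hrepl : ∀ j, ∀ s ≤ q, s ∈ repl j → s ∈ repl' j)
    (hexch : ∀ j k, ∀ s ≤ q, s ∈ exch j k → s ∈ exch' j k) {i : Fin N} {v : ℝ≥0} {a : Info N}
    (h : Knows x repl exch i v a) (hv : v ≤ q) : Knows x' repl' exch' i v a := by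
  induction h with
  | initial i t => rw [hx i 0 zero_le]; exact .initial i t
  | @replaced i u t hu hut =>
    rw [hx i u (hut.trans hv)]; exact .replaced (hrepl _ _ (hut.trans hv) hu) hut
  | @observed i j u t hu hut =>
    rw [hx j u (hut.trans hv)]; exact .observed (hexch _ _ _ (hut.trans hv) hu) hut
  | @recorded i j u t hu hut => exact .recorded (hexch _ _ _ (hut.trans hv) hu) hut
  | @received i j u w t a hu hut hwu ha ih =>
    exact .received (hexch _ _ _ (hut.trans hv) hu) hut hwu (ih (hwu.le.trans (hut.trans hv)))

/-- If the agent `i` receives nothing in `(q, t]`, then what it knows at time `t` depends only on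
its own values and replacements and on the evolution of the system up to time `q`. -/
lemma Knows.of_agree {N : ℕ} {x x' : Fin N → ℝ≥0 → ℝ} {repl repl' : Fin N → Set ℝ≥0}
    {exch exch' : Fin N → Fin N → Set ℝ≥0} {q t : ℝ≥0} {i : Fin N}
    (hx : ∀ j, ∀ s ≤ q, x j s = x' j s) (hrepl : ∀ j, ∀ s ≤ q, s ∈ repl j → s ∈ repl' j)
    (hexch : ∀ j k, ∀ s ≤ q, s ∈ exch j k → s ∈ exch' j k)
    (hxi : x i = x' i) (hrepli : repl i = repl' i) (hq : ∀ j, ∀ s ∈ exch j i, s ≤ t → s ≤ q)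
    {a : Info N} (h : Knows x repl exch i t a) : Knows x' repl' exch' i t a := by
  cases h with
  | initial => rw [hxi]; exact .initial i t
  | replaced hu hut => rw [hxi]; exact .replaced (hrepli ▸ hu) hut
  | @observed _ j u _ hu hut =>
    rw [hx j u (hq _ _ hu hut)]; exact .observed (hexch _ _ _ (hq _ _ hu hut) hu) hut
  | recorded hu hut => exact .recorded (hexch _ _ _ (hq _ _ hu hut) hu) hut
  | received hu hut hvu ha =>
    exact .received (hexch _ _ _ (hq _ _ hu hut) hu) hut hvu
      (ha.of_agree_le hx hrepl hexch (hvu.le.trans (hq _ _ hu hut)))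

/-! ### Systems stopped at the last exchange -/

section Stopped

/-- The family of paths in which that of label `j` is stopped at time `q`. -/
def stopAt {Ω : Type*} {N : ℕ} (Z : Fin N → ℝ≥0 → Ω → ℕ) (j : Fin N) (q : ℝ≥0) :
    Fin N → ℝ≥0 → Ω → ℕ :=
  fun l s => Z l (if l = j then min s q else s)

/-- The family of values in which those of label `j` after the `n`-th one are forgotten. -/
def truncAt {Ω : Type*} {N : ℕ} (X : Fin N → ℕ → Ω → ℝ) (j : Fin N) (n : ℕ) :
    Fin N → ℕ → Ω → ℝ :=
  fun l k => X l (if l = j then min k n else k)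

lemma IsCountingPath.comp_min {z : ℝ≥0 → ℕ} (hz : IsCountingPath z) (q : ℝ≥0) :
    IsCountingPath fun s => z (min s q) := by
  refine ⟨by simpa using hz.zero, fun s t h => hz.mono (min_le_min_right q h), fun t => ?_⟩
  exact ContinuousWithinAt.comp (t := Set.Ici (min t q)) (hz.right_continuous (min t q))
    (continuous_id.min continuous_const).continuousWithinAt fun s hs => min_le_min_right q hs

variable {Ω : Type*} {N : ℕ} {R P : Fin N → ℝ≥0 → Ω → ℕ} {X : Fin N → ℕ → Ω → ℝ}

lemma isCountingPath_stopAt (hR : ∀ i ω, IsCountingPath fun t => R i t ω) (j : Fin N) (q : ℝ≥0)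
    (i : Fin N) (ω : Ω) : IsCountingPath fun t => stopAt R j q i t ω := by
  by_cases h : i = j
  · simpa [stopAt, h] using (hR j ω).comp_min q
  · simpa [stopAt, h] using hR i ω

lemma mem_tickTimes_congr {z z' : ℝ≥0 → ℕ} {q : ℝ≥0} (h : ∀ s ≤ q, z s = z' s) {s : ℝ≥0}
    (hs : s ≤ q) : s ∈ tickTimes z ↔ s ∈ tickTimes z' := by
  refine and_congr_right fun _ => forall₂_congr fun r hr => ?_
  rw [h s hs, h r (hr.le.trans hs)]

/-- The stopped and truncated data carry no trace of the replacements of `j` after `q` or of its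
values of index above `n`. The identity therefore exhibits the knowledge of `i`, on the event
considered, as a function measurable for the past σ-algebra of `j`. -/
lemma pingKnowledge_stopAt {i j : Fin N} (hij : j ≠ i) {q t : ℝ≥0} {n : ℕ} {ω : Ω}
    (hR : IsCountingPath fun s => R j s ω) (hP : IsCountingPath fun s => P i s ω)
    (hn : R j q ω = n) (hPq : P i t ω = P i q ω) :
    pingKnowledge (stopAt R j q) (stopAt P i q) (truncAt X j n) i t ω
      = pingKnowledge R P X i t ω := by
  have hx : ∀ l, ∀ s ≤ q, value R X l s ω = value (stopAt R j q) (truncAt X j n) l s ω := by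
    intro l s hs
    by_cases hl : l = j
    · subst hl
      have h1 : R l s ω ≤ n := hn ▸ hR.mono hs
      simp [value, stopAt, truncAt, min_eq_left hs, min_eq_left h1]
    · simp [value, stopAt, truncAt, hl]
  have hZ : ∀ (Z : Fin N → ℝ≥0 → Ω → ℕ) (k l : Fin N), ∀ s ≤ q,
      Z l s ω = stopAt Z k q l s ω := by
    intro Z k l s hs
    by_cases hl : l = k <;> simp [stopAt, hl, min_eq_left hs]
  have hr : ∀ l, ∀ s ≤ q, s ∈ tickTimes (fun s => R l s ω) ↔
      s ∈ tickTimes (fun s => stopAt R j q l s ω) :=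
    fun l s hs => mem_tickTimes_congr (fun r hr => hZ R j l r hr) hs
  have hp : ∀ l, ∀ s ≤ q, s ∈ tickTimes (fun s => P l s ω) ↔
      s ∈ tickTimes (fun s => stopAt P i q l s ω) :=
    fun l s hs => mem_tickTimes_congr (fun r hr => hZ P i l r hr) hs
  have hxi : (fun s => value R X i s ω)
      = fun s => value (stopAt R j q) (truncAt X j n) i s ω := by
    ext s
    simp [value, stopAt, truncAt, hij.symm]
  have hri : tickTimes (fun s => R i s ω) = tickTimes (fun s => stopAt R j q i s ω) := by
    simp [stopAt, hij.symm]
  have hq1 : ∀ s ∈ tickTimes (fun s => P i s ω), s ≤ t → s ≤ q := by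
    rintro s ⟨-, hs⟩ hst
    by_contra! hqs
    have h1 : P i q ω < P i s ω := hs q hqs
    have h2 : P i s ω ≤ P i t ω := hP.mono hst
    omega
  have hq2 : ∀ s ∈ tickTimes (fun s => stopAt P i q i s ω), s ≤ t → s ≤ q := by
    rintro s ⟨-, hs⟩ hst
    by_contra! hqs
    have h1 := hs q hqs
    simp [stopAt, hqs.le] at h1
  ext a
  constructor
  · intro h
    change Knows _ _ _ _ _ _ at h ⊢
    refine Knows.of_agree (q := q) (fun l s hs => (hx l s hs).symm) (fun l s hs => (hr l s hs).2)
      ?_ hxi.symm hri.symm ?_ h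
    · exact fun l k s hs h => ⟨h.1, (hp k s hs).2 h.2⟩
    · exact fun l s hs => hq2 s hs.2
  · intro h
    change Knows _ _ _ _ _ _ at h ⊢
    refine Knows.of_agree (q := q) hx (fun l s hs => (hr l s hs).1) ?_ hxi hri ?_ h
    · exact fun l k s hs h => ⟨h.1, (hp k s hs).1 h.2⟩
    · exact fun l s hs => hq1 s hs.2

end Stopped

/-! ### Independence of the future of one agent from the past -/

section Independence

variable {Ω : Type*} {mΩ : MeasurableSpace Ω} {μ : Measure Ω}

/-- Intersections `s ∩ t` with `s` in `m₂` and `t` in `m₃` form a π-system generating the join, and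
the product formula on them follows from the two hypotheses. The sources of randomness are adjoined
one at a time with this lemma. -/
lemma indep_sup_right [IsProbabilityMeasure μ] {m₁ m₂ m₃ : MeasurableSpace Ω} (h₁ : m₁ ≤ mΩ)
    (h₂ : m₂ ≤ mΩ) (h₃ : m₃ ≤ mΩ) (h12 : Indep m₁ m₂ μ) (h123 : Indep (m₁ ⊔ m₂) m₃ μ) :
    Indep m₁ (m₂ ⊔ m₃) μ := by
  have h23 := indep_of_indep_of_le_left h123 (le_sup_right : m₂ ≤ m₁ ⊔ m₂)
  refine IndepSets.indep (p1 := {s | MeasurableSet[m₁] s})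
    (p2 := {u | ∃ s t, MeasurableSet[m₂] s ∧ MeasurableSet[m₃] t ∧ u = s ∩ t}) h₁
    (sup_le h₂ h₃) (@MeasurableSpace.isPiSystem_measurableSet _ m₁) ?_
    (@MeasurableSpace.generateFrom_measurableSet _ m₁).symm ?_ ?_
  · rintro _ ⟨s, t, hs, ht, rfl⟩ _ ⟨s', t', hs', ht', rfl⟩ -
    exact ⟨s ∩ s', t ∩ t', hs.inter hs', ht.inter ht', Set.inter_inter_inter_comm _ _ _ _⟩
  · refine le_antisymm (sup_le (fun s hs => ?_) fun t ht => ?_)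
      (MeasurableSpace.generateFrom_le ?_)
    · exact MeasurableSpace.measurableSet_generateFrom
        ⟨s, Set.univ, hs, MeasurableSet.univ, by simp⟩
    · exact MeasurableSpace.measurableSet_generateFrom
        ⟨Set.univ, t, MeasurableSet.univ, ht, by simp⟩
    · rintro _ ⟨s, t, hs, ht, rfl⟩
      exact ((le_sup_left : m₂ ≤ m₂ ⊔ m₃) s hs).inter ((le_sup_right : m₃ ≤ m₂ ⊔ m₃) t ht)
  · rw [IndepSets_iff]
    rintro r _ hr ⟨s, t, hs, ht, rfl⟩
    have hrs : MeasurableSet[m₁ ⊔ m₂] (r ∩ s) :=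
      ((le_sup_left : m₁ ≤ m₁ ⊔ m₂) r hr).inter ((le_sup_right : m₂ ≤ m₁ ⊔ m₂) s hs)
    rw [← Set.inter_assoc, (Indep_iff _ _ μ).1 h123 _ _ hrs ht, (Indep_iff _ _ μ).1 h12 _ _ hr hs,
      (Indep_iff _ _ μ).1 h23 _ _ hs ht, mul_assoc]

/-- Independence of increments is used along monotone sequences of times. Starting at `0`, where a
clock vanishes, makes each value of the clock a sum of increments. -/
lemma exists_monotone_seq_covering (F : Finset ℝ≥0) : ∃ (τ : ℕ → ℝ≥0) (m : ℕ), Monotone τ ∧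
    τ 0 = 0 ∧ (∀ s ∈ F, ∃ k ≤ m, τ k = s) ∧ ∀ k, τ k ∈ insert 0 F := by
  induction F using Finset.induction_on_max with
  | empty => exact ⟨fun _ => 0, 0, monotone_const, rfl, by simp, by simp⟩
  | insert a F ha ih =>
    obtain ⟨τ, m, hmono, h0, hcov, hmem⟩ := ih
    have hle : ∀ k, τ k ≤ a := by
      intro k
      rcases Finset.mem_insert.1 (hmem k) with h | h
      · rw [h]; exact zero_le
      · exact (ha _ h).le
    refine ⟨fun k => if k ≤ m then τ k else a, m + 1, ?_, by simpa using h0, ?_, ?_⟩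
    · intro k l hkl
      dsimp only
      split_ifs with h1 h2
      · exact hmono hkl
      · exact hle k
      · omega
      · exact le_rfl
    · intro s hs
      rcases Finset.mem_insert.1 hs with rfl | hs
      · exact ⟨m + 1, le_rfl, by simp⟩
      · obtain ⟨k, hk, rfl⟩ := hcov s hs
        exact ⟨k, by omega, by simp [hk]⟩
    · intro k
      dsimp only
      split_ifs
      · have := hmem k
        simp only [Finset.mem_insert] at this ⊢
        tauto
      · simp

lemma IsPoissonClock.indepFun_stopped_increment [IsProbabilityMeasure μ] {rate : ℝ≥0}
    {Z : ℝ≥0 → Ω → ℕ} (hZ : IsPoissonClock μ rate Z) {q t : ℝ≥0} (hqt : q ≤ t) :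
    IndepFun (fun ω => Z t ω - Z q ω) (fun ω (s : ℝ≥0) => Z (min s q) ω) μ := by
  refine IndepFun.indepFun_process ((hZ.measurable t).sub (hZ.measurable q))
    (fun s => hZ.measurable _) fun I => ?_
  obtain ⟨τ, m, hmono, h0, hcov, hmem⟩ := exists_monotone_seq_covering (I.image (min · q))
  have hle : ∀ k, τ k ≤ q := by
    intro k
    rcases Finset.mem_insert.1 (hmem k) with h | h
    · rw [h]; exact zero_le
    · obtain ⟨s, -, hs⟩ := Finset.mem_image.1 h
      rw [← hs]; exact min_le_right _ _
  -- The sequence is continued by `q` and then `t`: the increment of index `m + 1` is the one over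
  -- `(q, t]`, and those of index below `m` recover the stopped path.
  set τ' : ℕ → ℝ≥0 := fun k => if k ≤ m then τ k else if k = m + 1 then q else t with hτ'
  have hmono' : Monotone τ' := by
    intro k l hkl
    simp only [hτ']
    split_ifs <;> first | exact hmono hkl | exact hle _ | exact (hle _).trans hqt | omega | simp
  have hind := (hZ.indep_increments.nat hmono').indepFun_finset {m + 1} (Finset.range m)
    (by simp) (fun i => (hZ.measurable _).sub (hZ.measurable _))
  have hsum : ∀ k ≤ m, ∀ ω, Z (τ k) ω
      = ∑ i ∈ Finset.range k, (Z (τ' (i + 1)) ω - Z (τ' i) ω) := by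
    intro k hk ω
    induction k with
    | zero => simp [h0, hZ.zero]
    | succ k ih =>
      rw [Finset.sum_range_succ, ← ih (by omega)]
      have h1 : τ' (k + 1) = τ (k + 1) := by simp [hτ', hk]
      have h2 : τ' k = τ k := by simp [hτ', (by omega : k ≤ m)]
      rw [h1, h2]
      have := hZ.mono ω (hmono (Nat.le_succ k))
      simp only [Nat.succ_eq_add_one] at this
      omega
  choose! κ hκm hκ using fun s (hs : s ∈ I) => hcov _ (Finset.mem_image_of_mem (min · q) hs)
  have hφ : Measurable fun f : ({m + 1} : Finset ℕ) → ℕ => f ⟨m + 1, by simp⟩ :=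
    measurable_pi_apply _
  have := hind.comp (ψ := fun (f : Finset.range m → ℕ) (s : I) =>
    ∑ i : Finset.range m, if (i : ℕ) < κ s then f i else 0) hφ
    (measurable_pi_lambda _ fun s => Finset.measurable_sum _ fun i _ => by
      split_ifs
      · exact measurable_pi_apply i
      · exact measurable_const)
  convert this using 1
  · ext ω
    simp [hτ']
  · ext ω ⟨s, hs⟩
    simp only [Function.comp]
    rw [← hκ s hs, hsum _ (hκm s hs), Finset.sum_coe_sort (Finset.range m)
      (fun i => if i < κ s then Z (τ' (i + 1)) ω - Z (τ' i) ω else 0), ← Finset.sum_filter]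
    refine Finset.sum_congr ?_ fun _ _ => rfl
    ext i
    have := hκm s hs
    simp only [Finset.mem_range, Finset.mem_filter]
    omega

/-- The σ-algebra generated by a family of random variables. -/
abbrev procSigma {κ β : Type*} [MeasurableSpace β] (Z : κ → Ω → β) : MeasurableSpace Ω :=
  MeasurableSpace.comap (fun ω s => Z s ω) inferInstance

lemma measurable_procSigma {κ β : Type*} [MeasurableSpace β] (Z : κ → Ω → β) (s : κ) :
    Measurable[procSigma Z] (Z s) :=
  (@measurable_pi_iff _ _ _ (procSigma Z) _ _).1 (comap_measurable (fun ω s => Z s ω)) s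

lemma procSigma_le_iff {κ β : Type*} [MeasurableSpace β] {Z : κ → Ω → β}
    {m : MeasurableSpace Ω} : procSigma Z ≤ m ↔ ∀ s, Measurable[m] (Z s) := by
  refine ⟨fun h s => (measurable_procSigma Z s).mono h le_rfl, fun h => ?_⟩
  exact measurable_iff_comap_le.1 (measurable_pi_lambda _ h)

/-- The σ-algebra generated by a family of random variables indexed by two parameters. -/
abbrev familySigma {ι κ β : Type*} [MeasurableSpace β] (Z : ι → κ → Ω → β) : MeasurableSpace Ω :=
  MeasurableSpace.comap (fun ω i s => Z i s ω) inferInstance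

lemma measurable_familySigma {ι κ β : Type*} [MeasurableSpace β] (Z : ι → κ → Ω → β) (i : ι)
    (s : κ) : Measurable[familySigma Z] (Z i s) :=
  (@measurable_pi_iff _ _ _ (familySigma Z) _ _).1
    ((@measurable_pi_iff _ _ _ (familySigma Z) _ _).1
      (comap_measurable (fun ω i s => Z i s ω)) i) s

lemma familySigma_le_iff {ι κ β : Type*} [MeasurableSpace β] {Z : ι → κ → Ω → β}
    {m : MeasurableSpace Ω} : familySigma Z ≤ m ↔ ∀ i s, Measurable[m] (Z i s) := by
  refine ⟨fun h i s => (measurable_familySigma Z i s).mono h le_rfl, fun h => ?_⟩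
  exact measurable_iff_comap_le.1
    (measurable_pi_lambda _ fun i => measurable_pi_lambda _ fun s => h i s)

lemma familySigma_stopAt_le {N : ℕ} (R : Fin N → ℝ≥0 → Ω → ℕ) (j : Fin N) (q : ℝ≥0) :
    familySigma (stopAt R j q) ≤ familySigma R :=
  familySigma_le_iff.2 fun i _ => measurable_familySigma R i _

lemma familySigma_truncAt_le {N : ℕ} (X : Fin N → ℕ → Ω → ℝ) (j : Fin N) (n : ℕ) :
    familySigma (truncAt X j n) ≤ familySigma X :=
  familySigma_le_iff.2 fun i _ => measurable_familySigma X i _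

namespace IsPingSystem

variable {N : ℕ} {rateR rateP : ℝ≥0} {σ : ℝ} {ν : Measure ℝ}
  {R P : Fin N → ℝ≥0 → Ω → ℕ} {X : Fin N → ℕ → Ω → ℝ}

lemma replacement_le (h : IsPingSystem μ N rateR rateP σ ν R P X) : familySigma R ≤ mΩ :=
  familySigma_le_iff.2 fun i t => (h.replacement_clock i).measurable t

lemma ping_le (h : IsPingSystem μ N rateR rateP σ ν R P X) : familySigma P ≤ mΩ :=
  familySigma_le_iff.2 fun i t => (h.ping_clock i).measurable t

lemma value_le (h : IsPingSystem μ N rateR rateP σ ν R P X) : familySigma X ≤ mΩ :=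
  familySigma_le_iff.2 h.measurable_value

lemma indep_ping (h : IsPingSystem μ N rateR rateP σ ν R P X) :
    Indep (familySigma R ⊔ familySigma X) (familySigma P) μ := by
  have h1 := (IndepFun_iff_Indep _ _ _).1 h.pings_indep
  refine (indep_of_indep_of_le_right h1 ?_).symm
  refine sup_le ?_ ?_
  · exact measurable_iff_comap_le.1 (measurable_fst.comp (comap_measurable _))
  · exact measurable_iff_comap_le.1 (measurable_snd.comp (comap_measurable _))

/-- For the clock of `j` this is independence of increments; the clocks of the other agents, over
all times, are adjoined by their independence from that of `j`. -/
lemma indep_increment_stopAt [IsProbabilityMeasure μ]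
    (h : IsPingSystem μ N rateR rateP σ ν R P X) (j : Fin N)
    {q t : ℝ≥0} (hqt : q ≤ t) :
    Indep (MeasurableSpace.comap (fun ω => R j t ω - R j q ω) inferInstance)
      (familySigma (stopAt R j q)) μ := by
  have hm := fun i => (h.replacement_clock i).measurable
  have hle : ∀ i, procSigma (R i) ≤ mΩ := fun i => procSigma_le_iff.2 (hm i)
  have hΔ : MeasurableSpace.comap (fun ω => R j t ω - R j q ω) inferInstance ≤ procSigma (R j) :=
    measurable_iff_comap_le.1 ((measurable_procSigma (R j) t).sub (measurable_procSigma (R j) q))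
  have hS : procSigma (fun s => R j (min s q)) ≤ procSigma (R j) :=
    procSigma_le_iff.2 fun s => measurable_procSigma (R j) _
  have h1 : Indep (MeasurableSpace.comap (fun ω => R j t ω - R j q ω) inferInstance)
      (procSigma fun s => R j (min s q)) μ :=
    (IndepFun_iff_Indep _ _ _).1 ((h.replacement_clock j).indepFun_stopped_increment hqt)
  have h2 := indep_iSup_of_disjoint hle h.replacements_indep.iIndep
      (disjoint_compl_right (a := ({j} : Set (Fin N))))
  simp only [Set.mem_singleton_iff, iSup_iSup_eq_left] at h2
  refine indep_of_indep_of_le_right (indep_sup_right (hΔ.trans (hle j)) (hS.trans (hle j))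
    (iSup₂_le fun i _ => hle i) h1 (indep_of_indep_of_le_left h2 (sup_le hΔ hS))) ?_
  refine familySigma_le_iff.2 fun i s => ?_
  by_cases hi : i = j
  · subst hi
    have := measurable_procSigma (fun s => R i (min s q)) s
    simp only [stopAt, if_true]
    exact this.mono le_sup_left le_rfl
  · have := measurable_procSigma (R i) s
    simp only [stopAt, hi, if_false]
    exact this.mono ((le_iSup₂_of_le (f := fun (i : Fin N) (_ : i ∈ ({j}ᶜ : Set (Fin N))) =>
      procSigma (R i)) i hi le_rfl).trans le_sup_right) le_rfl

/-- The σ-algebra generated by all the clocks and values, except the replacements of agent `j` after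
time `q` and the values of label `j` after the `n`-th one. -/
abbrev _root_.PingModel.pastSigma {N : ℕ} (R P : Fin N → ℝ≥0 → Ω → ℕ) (X : Fin N → ℕ → Ω → ℝ)
    (j : Fin N) (q : ℝ≥0) (n : ℕ) : MeasurableSpace Ω :=
  familySigma (stopAt R j q) ⊔ familySigma (truncAt X j n) ⊔ familySigma P

lemma past_le (h : IsPingSystem μ N rateR rateP σ ν R P X) (j : Fin N) (q : ℝ≥0) (n : ℕ) :
    pastSigma R P X j q n ≤ mΩ :=
  sup_le (sup_le ((familySigma_stopAt_le R j q).trans h.replacement_le)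
    ((familySigma_truncAt_le X j n).trans h.value_le)) h.ping_le

lemma indep_increment_past [IsProbabilityMeasure μ]
    (h : IsPingSystem μ N rateR rateP σ ν R P X) (j : Fin N)
    {q t : ℝ≥0} (hqt : q ≤ t) (n : ℕ) :
    Indep (MeasurableSpace.comap (fun ω => R j t ω - R j q ω) inferInstance)
      (pastSigma R P X j q n) μ := by
  have hΔ : MeasurableSpace.comap (fun ω => R j t ω - R j q ω) inferInstance ≤ familySigma R :=
    measurable_iff_comap_le.1
      ((measurable_familySigma R j t).sub (measurable_familySigma R j q))
  have hS := familySigma_stopAt_le R j q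
  have hX := familySigma_truncAt_le X j n
  refine indep_sup_right (hΔ.trans h.replacement_le)
    (sup_le (hS.trans h.replacement_le) (hX.trans h.value_le)) h.ping_le
    (indep_sup_right (hΔ.trans h.replacement_le) (hS.trans h.replacement_le)
      (hX.trans h.value_le) (h.indep_increment_stopAt j hqt) ?_) ?_
  · exact indep_of_indep_of_le ((IndepFun_iff_Indep _ _ _).1 h.replacements_indep_values)
      (sup_le hΔ hS) hX
  · exact indep_of_indep_of_le_left h.indep_ping
      (sup_le (hΔ.trans le_sup_left) (sup_le_sup hS hX))

lemma comap_value_le (X : Fin N → ℕ → Ω → ℝ) (j : Fin N) (k : ℕ) :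
    MeasurableSpace.comap (X j k) inferInstance ≤ familySigma X :=
  measurable_iff_comap_le.1 (measurable_familySigma X j k)

lemma indep_value_clocks [IsProbabilityMeasure μ]
    (h : IsPingSystem μ N rateR rateP σ ν R P X) (j : Fin N) (k : ℕ) :
    Indep (MeasurableSpace.comap (X j k) inferInstance) (familySigma R ⊔ familySigma P) μ := by
  have hX := comap_value_le X j k
  refine indep_sup_right (hX.trans h.value_le) h.replacement_le h.ping_le ?_ ?_
  · exact indep_of_indep_of_le_left
      ((IndepFun_iff_Indep _ _ _).1 h.replacements_indep_values).symm hX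
  · exact indep_of_indep_of_le_left h.indep_ping (sup_le (hX.trans le_sup_right) le_sup_left)

/-- Here the whole replacement clocks are kept, so that a later value of `j` can be integrated out
on an event prescribing the number of replacements after `q`. -/
lemma indep_value_past [IsProbabilityMeasure μ]
    (h : IsPingSystem μ N rateR rateP σ ν R P X) (j : Fin N) {n k : ℕ}
    (hnk : n < k) :
    Indep (MeasurableSpace.comap (X j k) inferInstance)
      (familySigma (truncAt X j n) ⊔ familySigma R ⊔ familySigma P) μ := by
  have hX := comap_value_le X j k
  have hT := familySigma_truncAt_le X j n
  refine indep_sup_right (hX.trans h.value_le)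
    (sup_le (hT.trans h.value_le) h.replacement_le) h.ping_le
    (indep_sup_right (hX.trans h.value_le) (hT.trans h.value_le) h.replacement_le ?_ ?_) ?_
  · have hcomap : ∀ p : Fin N × ℕ, MeasurableSpace.comap (fun ω => X p.1 p.2 ω) inferInstance
        ≤ mΩ := fun p => measurable_iff_comap_le.1 (h.measurable_value p.1 p.2)
    have := indep_iSup_of_disjoint hcomap h.values_indep.iIndep
      (disjoint_compl_right (a := ({(j, k)} : Set (Fin N × ℕ))))
    refine indep_of_indep_of_le this (by simp) (familySigma_le_iff.2 fun i l => ?_)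
    have hne : (i, if i = j then min l n else l) ∈ ({(j, k)}ᶜ : Set (Fin N × ℕ)) := by
      simp only [Set.mem_compl_iff, Set.mem_singleton_iff, Prod.mk.injEq, not_and]
      rintro rfl
      simp only [if_true]
      omega
    exact (comap_measurable (X i _)).mono
      (le_iSup₂_of_le (f := fun (p : Fin N × ℕ) (_ : p ∈ ({(j, k)}ᶜ : Set (Fin N × ℕ))) =>
        MeasurableSpace.comap (fun ω => X p.1 p.2 ω) inferInstance) _ hne le_rfl) le_rfl
  · exact indep_of_indep_of_le ((IndepFun_iff_Indep _ _ _).1 h.replacements_indep_values).symm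
      (sup_le hX hT) le_rfl
  · exact indep_of_indep_of_le_left h.indep_ping
      (sup_le (hX.trans le_sup_right) (sup_le (hT.trans le_sup_right) le_sup_left))

end IsPingSystem

end Independence

/-! ### Variance of the fresh part of one value -/

section Step

lemma lintegral_add_sq_of_centered {ν : Measure ℝ} [IsProbabilityMeasure ν] {σ : ℝ}
    (hmem : MemLp (fun v : ℝ => v) 2 ν) (hmean : ∫ v, v ∂ν = 0) (hvar : ∫ v, v ^ 2 ∂ν = σ ^ 2)
    (c : ℝ) : ∫⁻ v, ENNReal.ofReal ((c + v) ^ 2) ∂ν = ENNReal.ofReal (c ^ 2 + σ ^ 2) := by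
  have h1 : Integrable (fun v : ℝ => v) ν := hmem.integrable (by norm_num)
  have h2 : Integrable (fun v : ℝ => v ^ 2) ν := hmem.integrable_sq
  have h3 : ∀ v : ℝ, (c + v) ^ 2 = c ^ 2 + 2 * c * v + v ^ 2 := fun v => by ring
  simp_rw [h3]
  have h4 : Integrable (fun v : ℝ => c ^ 2 + 2 * c * v) ν :=
    (integrable_const _).add (h1.const_mul _)
  have h5 : Integrable (fun v : ℝ => c ^ 2 + 2 * c * v + v ^ 2) ν := h4.add h2
  rw [← ofReal_integral_eq_lintegral_ofReal h5
    (Eventually.of_forall fun v => (sq_nonneg (c + v)).trans_eq (h3 v)),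
    integral_add h4 h2, integral_add (integrable_const _) (h1.const_mul _), integral_const_mul,
    hmean, hvar]
  simp

variable {Ω : Type*} {m mΩ : MeasurableSpace Ω} {μ : Measure Ω}

/-- Tonelli for the joint law of `(G, 1_S)` and `Y`: integrating out the centered `Y` first kills
the cross term pointwise in `G`, so `G` need not be integrable. -/
lemma setLIntegral_add_sq_of_indep [IsProbabilityMeasure μ] {ν : Measure ℝ} {σ : ℝ}
    (hmem : MemLp (fun v : ℝ => v) 2 ν) (hmean : ∫ v, v ∂ν = 0) (hvar : ∫ v, v ^ 2 ∂ν = σ ^ 2)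
    {Y : Ω → ℝ} (hY : Measurable Y) (hlaw : HasLaw Y ν μ) (hm : m ≤ mΩ)
    (hind : Indep (MeasurableSpace.comap Y inferInstance) m μ) {G : Ω → ℝ} (hG : Measurable[m] G)
    {S : Set Ω} (hS : MeasurableSet[m] S) :
    ∫⁻ ω in S, ENNReal.ofReal ((G ω + Y ω) ^ 2) ∂μ
      = ∫⁻ ω in S, ENNReal.ofReal (G ω ^ 2 + σ ^ 2) ∂μ := by
  have : IsProbabilityMeasure ν := hlaw.isProbabilityMeasure_iff.1 inferInstance
  set Z : Ω → ℝ × ℝ≥0∞ := fun ω => (G ω, S.indicator (fun _ => 1) ω) with hZdef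
  have hZm : Measurable[m] Z := hG.prodMk (measurable_const.indicator hS)
  have hZ : Measurable Z := hZm.mono hm le_rfl
  have hZY : IndepFun Z Y μ := by
    rw [IndepFun_iff_Indep]
    exact (indep_of_indep_of_le_right hind (measurable_iff_comap_le.1 hZm)).symm
  have hmul : ∀ f : Ω → ℝ≥0∞, ∫⁻ ω in S, f ω ∂μ = ∫⁻ ω, (Z ω).2 * f ω ∂μ := by
    intro f
    rw [← lintegral_indicator (hm _ hS)]
    refine lintegral_congr fun ω => ?_
    by_cases hω : ω ∈ S <;> simp [hZdef, hω]
  rw [hmul, hmul]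
  have hF : Measurable fun z : (ℝ × ℝ≥0∞) × ℝ => z.1.2 * ENNReal.ofReal ((z.1.1 + z.2) ^ 2) := by
    fun_prop
  have h1 := lintegral_map (μ := μ) hF (hZ.prodMk hY)
  rw [(indepFun_iff_map_prod_eq_prod_map_map hZ.aemeasurable hY.aemeasurable).1 hZY,
    lintegral_prod _ hF.aemeasurable, hlaw.map_eq] at h1
  refine h1.symm.trans ?_
  rw [lintegral_map (by fun_prop) hZ]
  refine lintegral_congr fun ω => ?_
  rw [lintegral_const_mul _ (by fun_prop), lintegral_add_sq_of_centered hmem hmean hvar]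

lemma setLIntegral_inter_of_indep {m₁ m₂ : MeasurableSpace Ω} (h₁ : m₁ ≤ mΩ) (h₂ : m₂ ≤ mΩ)
    (hind : Indep m₁ m₂ μ) {D S : Set Ω} (hD : MeasurableSet[m₁] D) (hS : MeasurableSet[m₂] S)
    {f : Ω → ℝ≥0∞} (hf : Measurable[m₂] f) :
    ∫⁻ ω in S ∩ D, f ω ∂μ = μ D * ∫⁻ ω in S, f ω ∂μ := by
  have h := lintegral_mul_eq_lintegral_mul_lintegral_of_independent_measurableSpace h₁ h₂ hind
    (f := D.indicator fun _ => 1) (g := S.indicator f) (measurable_const.indicator hD)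
    (hf.indicator hS)
  rw [lintegral_indicator (h₁ _ hD), lintegral_indicator (h₂ _ hS)] at h
  simp only [lintegral_const, one_mul, Measure.restrict_apply_univ] at h
  rw [← h, ← lintegral_indicator ((h₂ _ hS).inter (h₁ _ hD))]
  refine lintegral_congr fun ω => ?_
  by_cases hω : ω ∈ S <;> by_cases hω' : ω ∈ D <;> simp [hω, hω']

namespace IsPingSystem

variable {N : ℕ} {rateR rateP : ℝ≥0} {σ : ℝ} {ν : Measure ℝ}
  {R P : Fin N → ℝ≥0 → Ω → ℕ} {X : Fin N → ℕ → Ω → ℝ}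

lemma _root_.PingModel.IsPoissonClock.measure_eq {rate : ℝ≥0} {Z : ℝ≥0 → Ω → ℕ}
    (hZ : IsPoissonClock μ rate Z) {s t : ℝ≥0} (hst : s ≤ t) :
    μ {ω | Z t ω - Z s ω = 0} = ENNReal.ofReal (Real.exp (-(rate * (t - s) : ℝ≥0))) := by
  rw [(hZ.law_increment s t hst).measure_eq (p := fun k => k = 0) (measurableSet_singleton 0)]
  simp only [Set.ofPred_eq_eq_singleton, poissonMeasure_singleton]
  simp

/-- `H` is a function of the information available before the replacements of agent `j` after time
`q`, at least on the event `A`. -/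
def _root_.PingModel.IsPast (R P : Fin N → ℝ≥0 → Ω → ℕ) (X : Fin N → ℕ → Ω → ℝ) (j : Fin N)
    (q : ℝ≥0) (A : Set Ω) (H : Ω → ℝ) : Prop :=
  ∀ n, ∃ H' : Ω → ℝ, Measurable[pastSigma R P X j q n] H' ∧
    ∀ ω ∈ A, R j q ω = n → H ω = H' ω

/-- Split according to the number of replacements of `j` in `(q, t]`. With none, of probability `p`,
the value stays `X j n`; otherwise it is a new value independent of everything else present. Fixing
the count `n` at time `q` makes the indices of both values deterministic on each piece. The past
contains `X j n`, hence the separate assumption that `S` is an event of the clocks. -/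
lemma setLIntegral_fresh_of_count [IsProbabilityMeasure μ]
    (h : IsPingSystem μ N rateR rateP σ ν R P X) (j : Fin N)
    {q t : ℝ≥0} (hqt : q ≤ t) {n : ℕ} {S : Set Ω} (hS : MeasurableSet[pastSigma R P X j q n] S)
    (hSP : MeasurableSet[familySigma R ⊔ familySigma P] S) (hSn : ∀ ω ∈ S, R j q ω = n)
    {H : Ω → ℝ} (hH : Measurable[pastSigma R P X j q n] H) {p : ℝ}
    (hp : p = Real.exp (-(rateR * (t - q) : ℝ≥0))) :
    ∫⁻ ω in S, ENNReal.ofReal ((value R X j t ω - p * value R X j q ω + H ω) ^ 2) ∂μ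
      = ENNReal.ofReal ((1 - p ^ 2) * σ ^ 2) * μ S
        + ∫⁻ ω in S, ENNReal.ofReal (H ω ^ 2) ∂μ := by
  have hp0 : 0 ≤ p := hp ▸ (Real.exp_pos _).le
  have hp1 : p ≤ 1 := by
    rw [hp, Real.exp_le_one_iff, neg_nonpos]
    exact NNReal.coe_nonneg _
  have hRm := (h.replacement_clock j).measurable
  have hΔm : Measurable fun ω => R j t ω - R j q ω := (hRm t).sub (hRm q)
  have hpast := h.past_le j q n
  have hSm := hpast _ hS
  set D : ℕ → Set Ω := fun k => {ω | R j t ω - R j q ω = k} with hD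
  have hDm : ∀ k, MeasurableSet (D k) := fun k => hΔm (measurableSet_singleton k)
  have hDΔ : ∀ k, MeasurableSet[MeasurableSpace.comap (fun ω => R j t ω - R j q ω) inferInstance]
      (D k) := fun k => ⟨{k}, measurableSet_singleton k, rfl⟩
  have hdisj : Pairwise (Function.onFun Disjoint D) := fun k l hkl =>
    Set.disjoint_left.2 fun ω hk hl => hkl (Eq.trans (Eq.symm hk) hl)
  have hunion : ⋃ k, D k = Set.univ := Set.eq_univ_of_forall fun ω =>
    Set.mem_iUnion.2 ⟨R j t ω - R j q ω, rfl⟩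
  have hSunion : S = ⋃ k, S ∩ D k := by rw [← Set.inter_iUnion, hunion, Set.inter_univ]
  have hX : Measurable[pastSigma R P X j q n] (X j n) := by
    have : truncAt X j n j n = X j n := by simp [truncAt]
    rw [← this]
    exact (measurable_familySigma (truncAt X j n) j n).mono
      (le_sup_right.trans le_sup_left) le_rfl
  have hcount : ∀ k, ∀ ω ∈ S ∩ D k, value R X j t ω = X j (n + k) ω ∧
      value R X j q ω = X j n ω := by
    rintro k ω ⟨hω, hk⟩
    have h1 := hSn ω hω
    have h2 : R j t ω - R j q ω = k := hk
    have h3 : R j q ω ≤ R j t ω := (h.replacement_clock j).mono ω hqt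
    have h4 : R j t ω = n + k := by omega
    simp [value, h1, h4]
  have hmΔ : MeasurableSpace.comap (fun ω => R j t ω - R j q ω) inferInstance ≤ mΩ :=
    measurable_iff_comap_le.1 hΔm
  have hind := h.indep_increment_past j hqt n
  have hzero : ∫⁻ ω in S ∩ D 0,
      ENNReal.ofReal ((value R X j t ω - p * value R X j q ω + H ω) ^ 2) ∂μ
      = ENNReal.ofReal p * ∫⁻ ω in S, ENNReal.ofReal (((1 - p) * X j n ω + H ω) ^ 2) ∂μ := by
    have h0 : μ (D 0) = ENNReal.ofReal p := hp ▸ (h.replacement_clock j).measure_eq hqt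
    have hf : Measurable[pastSigma R P X j q n]
        fun ω => ENNReal.ofReal (((1 - p) * X j n ω + H ω) ^ 2) :=
      (((hX.const_mul _).add hH).pow_const 2).ennreal_ofReal
    rw [← h0, ← setLIntegral_inter_of_indep hmΔ hpast hind (hDΔ 0) hS hf]
    refine setLIntegral_congr_fun (hSm.inter (hDm 0)) fun ω hω => ?_
    obtain ⟨h1, h2⟩ := hcount 0 ω hω
    rw [h1, h2, add_zero]
    ring_nf
  have hsucc : ∀ k, ∫⁻ ω in S ∩ D (k + 1),
      ENNReal.ofReal ((value R X j t ω - p * value R X j q ω + H ω) ^ 2) ∂μ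
      = μ (D (k + 1)) * ∫⁻ ω in S, ENNReal.ofReal ((H ω - p * X j n ω) ^ 2 + σ ^ 2) ∂μ := by
    intro k
    have hG : Measurable[pastSigma R P X j q n] fun ω => H ω - p * X j n ω :=
      hH.sub (hX.const_mul _)
    have hle : pastSigma R P X j q n
        ≤ familySigma (truncAt X j n) ⊔ familySigma R ⊔ familySigma P :=
      sup_le_sup_right (sup_le ((familySigma_stopAt_le R j q).trans le_sup_right) le_sup_left) _
    have hRle : familySigma R ≤ familySigma (truncAt X j n) ⊔ familySigma R ⊔ familySigma P :=
      le_sup_right.trans le_sup_left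
    have hDR : MeasurableSet[familySigma R] (D (k + 1)) :=
      ((measurable_familySigma R j t).sub (measurable_familySigma R j q))
        (measurableSet_singleton _)
    rw [← setLIntegral_inter_of_indep hmΔ hpast hind (hDΔ (k + 1)) hS
      ((hG.pow_const 2).add_const _).ennreal_ofReal,
      ← setLIntegral_add_sq_of_indep h.memLp_value h.mean_value h.variance_value
        (h.measurable_value j (n + (k + 1))) (h.law_value j _)
        (sup_le (sup_le ((familySigma_truncAt_le X j n).trans h.value_le) h.replacement_le)
          h.ping_le)
        (h.indep_value_past j (by omega)) (hG.mono hle le_rfl)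
        ((hle _ hS).inter (hRle _ hDR))]
    refine setLIntegral_congr_fun (hSm.inter (hDm _)) fun ω hω => ?_
    obtain ⟨h1, h2⟩ := hcount (k + 1) ω hω
    rw [h1, h2]
    ring_nf
  have hsum : ∑' k, μ (D (k + 1)) = ENNReal.ofReal (1 - p) := by
    have h1 : μ Set.univ = ∑' k, μ (D k) := by rw [← hunion, measure_iUnion hdisj hDm]
    have h0 : μ (D 0) = ENNReal.ofReal p := hp ▸ (h.replacement_clock j).measure_eq hqt
    rw [measure_univ, tsum_eq_zero_add' ENNReal.summable, h0] at h1
    rw [ENNReal.ofReal_sub _ hp0, ENNReal.ofReal_one, h1,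
      ENNReal.add_sub_cancel_left ENNReal.ofReal_ne_top]
  -- The case `G = 0` of the addition formula.
  have hsq : ∫⁻ ω in S, ENNReal.ofReal (X j n ω ^ 2) ∂μ = ENNReal.ofReal (σ ^ 2) * μ S := by
    have := setLIntegral_add_sq_of_indep h.memLp_value h.mean_value h.variance_value
      (h.measurable_value j n) (h.law_value j n) (sup_le h.replacement_le h.ping_le)
      (h.indep_value_clocks j n) (G := fun _ => 0) measurable_const hSP
    simpa using this
  have hHm : Measurable H := hH.mono hpast le_rfl
  have hXm := h.measurable_value j n
  conv_lhs => rw [hSunion]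
  rw [lintegral_iUnion (fun k => hSm.inter (hDm k)) (fun k l hkl =>
      (hdisj hkl).mono Set.inter_subset_right Set.inter_subset_right),
    tsum_eq_zero_add' ENNReal.summable, hzero]
  simp_rw [hsucc]
  rw [ENNReal.tsum_mul_right, hsum, ← lintegral_const_mul _ (by fun_prop),
    ← lintegral_const_mul _ (by fun_prop), ← lintegral_add_left (by fun_prop)]
  -- The cross terms `± 2 p (1 - p) X H` cancel: this is where the coefficient `p` of the prediction
  -- matters. The remaining weights give `p (1 - p) + (1 - p) = 1 - p²`.
  have hpt : ∀ ω, ENNReal.ofReal p * ENNReal.ofReal (((1 - p) * X j n ω + H ω) ^ 2)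
      + ENNReal.ofReal (1 - p) * ENNReal.ofReal ((H ω - p * X j n ω) ^ 2 + σ ^ 2)
      = ENNReal.ofReal (p * (1 - p)) * ENNReal.ofReal (X j n ω ^ 2)
        + ENNReal.ofReal ((1 - p) * σ ^ 2) + ENNReal.ofReal (H ω ^ 2) := by
    intro ω
    have hp1' : 0 ≤ 1 - p := by linarith
    rw [← ENNReal.ofReal_mul hp0, ← ENNReal.ofReal_mul hp1', ← ENNReal.ofReal_mul (by positivity),
      ← ENNReal.ofReal_add (by positivity) (by positivity),
      ← ENNReal.ofReal_add (by positivity) (by positivity),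
      ← ENNReal.ofReal_add (by positivity) (by positivity)]
    ring_nf
  simp_rw [hpt]
  have hp1' : 0 ≤ 1 - p := by linarith
  rw [lintegral_add_left (by fun_prop), lintegral_add_left (by fun_prop),
    lintegral_const_mul _ (by fun_prop), hsq, lintegral_const, Measure.restrict_apply_univ,
    ← mul_assoc, ← add_mul, ← ENNReal.ofReal_mul (by positivity),
    ← ENNReal.ofReal_add (by positivity) (by positivity)]
  ring_nf

/-- The part of the value of agent `j` which cannot be predicted from the past at time `q`
contributes its variance to the mean squared error. -/
lemma setLIntegral_fresh [IsProbabilityMeasure μ]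
    (h : IsPingSystem μ N rateR rateP σ ν R P X) (j : Fin N)
    {q t : ℝ≥0} (hqt : q ≤ t) {A : Set Ω} (hA : MeasurableSet[familySigma P] A)
    {H : Ω → ℝ} (hH : IsPast R P X j q A H) {p : ℝ}
    (hp : p = Real.exp (-(rateR * (t - q) : ℝ≥0))) :
    ∫⁻ ω in A, ENNReal.ofReal ((value R X j t ω - p * value R X j q ω + H ω) ^ 2) ∂μ
      = ENNReal.ofReal ((1 - p ^ 2) * σ ^ 2) * μ A
        + ∫⁻ ω in A, ENNReal.ofReal (H ω ^ 2) ∂μ := by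
  -- Partitioning by the replacement count at `q` avoids a σ-algebra with a random number of values.
  set S : ℕ → Set Ω := fun n => A ∩ {ω | R j q ω = n} with hSdef
  have hn : ∀ n, MeasurableSet {ω | R j q ω = n} := fun n =>
    (h.replacement_clock j).measurable q (measurableSet_singleton n)
  have hSm : ∀ n, MeasurableSet (S n) := fun n => (h.ping_le _ hA).inter (hn n)
  have hdisj : Pairwise (Function.onFun Disjoint S) := fun k l hkl =>
    Set.disjoint_left.2 fun ω hk hl => hkl (Eq.trans (Eq.symm hk.2) hl.2)
  have hunion : A = ⋃ n, S n := by
    ext ω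
    simp [hSdef]
  have key : ∀ n, ∫⁻ ω in S n,
      ENNReal.ofReal ((value R X j t ω - p * value R X j q ω + H ω) ^ 2) ∂μ
      = ENNReal.ofReal ((1 - p ^ 2) * σ ^ 2) * μ (S n)
        + ∫⁻ ω in S n, ENNReal.ofReal (H ω ^ 2) ∂μ := by
    intro n
    obtain ⟨H', hH', heq⟩ := hH n
    have e : ∀ ω ∈ S n, H ω = H' ω := fun ω hω => heq ω hω.1 hω.2
    have hpast : MeasurableSet[pastSigma R P X j q n] (S n) := by
      refine ((le_sup_right : familySigma P ≤ pastSigma R P X j q n) _ hA).inter ?_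
      have h1 : stopAt R j q j q = R j q := by simp [stopAt]
      have h2 := measurable_familySigma (stopAt R j q) j q (measurableSet_singleton n)
      rw [h1] at h2
      exact (le_sup_left.trans le_sup_left : familySigma (stopAt R j q) ≤ _) _ h2
    have hclock : MeasurableSet[familySigma R ⊔ familySigma P] (S n) :=
      ((le_sup_right : familySigma P ≤ familySigma R ⊔ familySigma P) _ hA).inter
        ((le_sup_left : familySigma R ≤ familySigma R ⊔ familySigma P) _
          (measurable_familySigma R j q (measurableSet_singleton n)))
    have h1 := h.setLIntegral_fresh_of_count j hqt hpast hclock (fun ω hω => hω.2) hH' hp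
    have h2 : ∫⁻ ω in S n, ENNReal.ofReal (H ω ^ 2) ∂μ
        = ∫⁻ ω in S n, ENNReal.ofReal (H' ω ^ 2) ∂μ :=
      setLIntegral_congr_fun (hSm n) fun ω hω => by simp only [e ω hω]
    rw [h2, ← h1]
    exact setLIntegral_congr_fun (hSm n) fun ω hω => by simp only [e ω hω]
  rw [hunion, lintegral_iUnion hSm hdisj, lintegral_iUnion hSm hdisj, measure_iUnion hdisj hSm]
  simp_rw [key]
  rw [ENNReal.tsum_add, ENNReal.tsum_mul_left]

end IsPingSystem

end Step

/-! ### Lower bound at a fixed time -/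

section Bound

variable {Ω : Type*} {mΩ : MeasurableSpace Ω} {μ : Measure Ω}
  {N : ℕ} {rateR rateP : ℝ≥0} {σ : ℝ} {ν : Measure ℝ}
  {R P : Fin N → ℝ≥0 → Ω → ℕ} {X : Fin N → ℕ → Ω → ℝ}

lemma measurable_value_of_le {R : Fin N → ℝ≥0 → Ω → ℕ} {X : Fin N → ℕ → Ω → ℝ}
    {m : MeasurableSpace Ω} (hR : familySigma R ≤ m) (hX : familySigma X ≤ m) (l : Fin N)
    (s : ℝ≥0) : Measurable[m] (value R X l s) :=
  measurable_index_comp (m := m) (fun k => (measurable_familySigma X l k).mono hX le_rfl)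
    ((measurable_familySigma R l s).mono hR le_rfl)

namespace IsPingSystem

lemma measurable_estimate (h : IsPingSystem μ N rateR rateP σ ν R P X)
    {g : Set (Info N) → ℝ} (hg : Measurable[knowledgeSigma N] g) (i : Fin N) (t : ℝ≥0) :
    Measurable fun ω => g (pingKnowledge R P X i t ω) :=
  @Measurable.comp _ _ _ mΩ (knowledgeSigma N) _ _ _ hg (measurable_pingKnowledge
    (fun i ω => (h.replacement_clock i).isCountingPath ω)
    (fun i ω => (h.ping_clock i).isCountingPath ω)
    (fun i => (h.replacement_clock i).measurable) (fun i => (h.ping_clock i).measurable)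
    h.measurable_value i t)

lemma measurable_current_value (h : IsPingSystem μ N rateR rateP σ ν R P X) (i : Fin N) (t : ℝ≥0) :
    Measurable (value R X i t) :=
  measurable_value_of_le h.replacement_le h.value_le i t

/-- The error of agent `i`, after the fresh parts of the values of the agents outside `s` are
removed, is a function of the past of any `j ∉ s` as long as `i` receives nothing. -/
lemma isPast_remainder (h : IsPingSystem μ N rateR rateP σ ν R P X) {i j : Fin N} (hij : j ≠ i)
    {q t : ℝ≥0} {A : Set Ω} (hAq : ∀ ω ∈ A, P i t ω = P i q ω) {g : Set (Info N) → ℝ}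
    (hg : Measurable[knowledgeSigma N] g) (p : ℝ) {s : Finset (Fin N)} (hjs : j ∉ s) :
    IsPast R P X j q A fun ω => ∑ l ∈ s, (value R X l t ω - p * value R X l q ω)
      + (value R X i t ω + p * ∑ l ∈ Finset.univ.erase i, value R X l q ω
        - N * g (pingKnowledge R P X i t ω)) := by
  intro n
  have hRle : familySigma (stopAt R j q) ≤ pastSigma R P X j q n := le_sup_left.trans le_sup_left
  have hXle : familySigma (truncAt X j n) ≤ pastSigma R P X j q n :=
    le_sup_right.trans le_sup_left
  have hPle : familySigma P ≤ pastSigma R P X j q n := le_sup_right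
  have hv := measurable_value_of_le hRle hXle
  refine ⟨fun ω => ∑ l ∈ s, (value (stopAt R j q) (truncAt X j n) l t ω
      - p * value (stopAt R j q) (truncAt X j n) l q ω)
      + (value (stopAt R j q) (truncAt X j n) i t ω
        + p * ∑ l ∈ Finset.univ.erase i, value (stopAt R j q) (truncAt X j n) l q ω
        - N * g (pingKnowledge (stopAt R j q) (stopAt P i q) (truncAt X j n) i t ω)), ?_, ?_⟩
  · have hK : Measurable[pastSigma R P X j q n] fun ω =>
        g (pingKnowledge (stopAt R j q) (stopAt P i q) (truncAt X j n) i t ω) :=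
      @Measurable.comp _ _ _ (pastSigma R P X j q n) (knowledgeSigma N) _ _ _ hg
        (measurable_pingKnowledge (m := pastSigma R P X j q n)
          (isCountingPath_stopAt (fun i ω => (h.replacement_clock i).isCountingPath ω) j q)
          (isCountingPath_stopAt (fun i ω => (h.ping_clock i).isCountingPath ω) i q)
          (fun l s => (measurable_familySigma _ l s).mono hRle le_rfl)
          (fun l s => (measurable_familySigma P l _).mono hPle le_rfl)
          (fun l k => (measurable_familySigma _ l k).mono hXle le_rfl) i t)
    exact (Finset.measurable_sum _ fun l _ => (hv l t).sub ((hv l q).const_mul p)).add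
      (((hv i t).add ((Finset.measurable_sum _ fun l _ => hv l q).const_mul p)).sub
        (hK.const_mul _))
  · intro ω hω hn
    have h1 : ∀ l ≠ j, ∀ r, value (stopAt R j q) (truncAt X j n) l r ω = value R X l r ω := by
      intro l hl r
      simp [value, stopAt, truncAt, hl]
    have h2 : ∀ l, value (stopAt R j q) (truncAt X j n) l q ω = value R X l q ω := by
      intro l
      by_cases hl : l = j
      · subst hl
        simp [value, stopAt, truncAt, hn]
      · exact h1 l hl q
    have h3 := pingKnowledge_stopAt (X := X) hij ((h.replacement_clock j).isCountingPath ω)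
      ((h.ping_clock i).isCountingPath ω) hn (hAq ω hω)
    simp_rw [h3, h2, h1 i hij.symm]
    congr 1
    exact Finset.sum_congr rfl fun l hl => by rw [h1 l (fun e => hjs (e ▸ hl))]

/-- Induction on `s`: the sum over the other agents, together with the remainder, belongs to the
past of the inserted agent, so each insertion adds exactly one variance. The remainder is bounded
below by zero at the end. -/
lemma le_setLIntegral_sum_fresh [IsProbabilityMeasure μ]
    (h : IsPingSystem μ N rateR rateP σ ν R P X) {i : Fin N}
    {q t : ℝ≥0} (hqt : q ≤ t) {A : Set Ω} (hA : MeasurableSet[familySigma P] A)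
    (hAq : ∀ ω ∈ A, P i t ω = P i q ω) {g : Set (Info N) → ℝ}
    (hg : Measurable[knowledgeSigma N] g) {p : ℝ}
    (hp : p = Real.exp (-(rateR * (t - q) : ℝ≥0))) (s : Finset (Fin N)) (his : i ∉ s) :
    ENNReal.ofReal (s.card * ((1 - p ^ 2) * σ ^ 2)) * μ A ≤
      ∫⁻ ω in A, ENNReal.ofReal ((∑ l ∈ s, (value R X l t ω - p * value R X l q ω)
      + (value R X i t ω + p * ∑ l ∈ Finset.univ.erase i, value R X l q ω
        - N * g (pingKnowledge R P X i t ω))) ^ 2) ∂μ := by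
  have hp0 : 0 ≤ p := hp ▸ (Real.exp_pos _).le
  have hp1 : p ≤ 1 := by
    rw [hp, Real.exp_le_one_iff, neg_nonpos]
    exact NNReal.coe_nonneg _
  have hc : 0 ≤ (1 - p ^ 2) * σ ^ 2 := mul_nonneg (by nlinarith) (sq_nonneg _)
  induction s using Finset.induction_on with
  | empty => simp
  | insert j s hjs ih =>
    have hji : j ≠ i := fun e => his (e ▸ Finset.mem_insert_self j s)
    simp_rw [Finset.sum_insert hjs, add_assoc (value R X j t _ - p * value R X j q _)]
    rw [h.setLIntegral_fresh j hqt hA (h.isPast_remainder hji hAq hg p hjs) hp,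
      Finset.card_insert_of_notMem hjs, Nat.cast_add_one, add_mul, one_mul, add_comm,
      ENNReal.ofReal_add hc (by positivity), add_mul]
    exact add_le_add_right (ih fun hi => his (Finset.mem_insert_of_mem hi)) _

/-- Lower bound for the mean squared error of agent `i` on an event on which it receives nothing
during `(q, t]`. -/
lemma le_setLIntegral_error [IsProbabilityMeasure μ]
    (h : IsPingSystem μ N rateR rateP σ ν R P X) {i : Fin N}
    {q t : ℝ≥0} (hqt : q ≤ t) {A : Set Ω} (hA : MeasurableSet[familySigma P] A)
    (hAq : ∀ ω ∈ A, P i t ω = P i q ω) {g : Set (Info N) → ℝ}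
    (hg : Measurable[knowledgeSigma N] g) {p : ℝ}
    (hp : p = Real.exp (-(rateR * (t - q) : ℝ≥0))) :
    ENNReal.ofReal (((N : ℝ) - 1) / (N : ℝ) ^ 2 * σ ^ 2 * (1 - p ^ 2)) * μ A ≤
      ∫⁻ ω in A, ENNReal.ofReal ((average R X t ω - g (pingKnowledge R P X i t ω)) ^ 2) ∂μ := by
  have hN : (N : ℝ) ≠ 0 := by
    have := i.pos
    positivity
  have hkey := h.le_setLIntegral_sum_fresh hqt hA hAq hg hp (Finset.univ.erase i) (by simp)
  have hcard : (((Finset.univ.erase i).card : ℕ) : ℝ) = N - 1 := by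
    rw [Finset.card_erase_of_mem (Finset.mem_univ i), Finset.card_univ, Fintype.card_fin,
      Nat.cast_sub i.pos, Nat.cast_one]
  -- The predictions `p x_l(q)` subtracted in the fresh parts are restored by the remainder.
  have herr : ∀ ω, ∑ l ∈ Finset.univ.erase i, (value R X l t ω - p * value R X l q ω)
      + (value R X i t ω + p * ∑ l ∈ Finset.univ.erase i, value R X l q ω
        - N * g (pingKnowledge R P X i t ω))
      = N * (average R X t ω - g (pingKnowledge R P X i t ω)) := by
    intro ω
    have h1 : ∑ l, value R X l t ω
        = ∑ l ∈ Finset.univ.erase i, value R X l t ω + value R X i t ω :=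
      (Finset.sum_erase_add _ _ (Finset.mem_univ i)).symm
    rw [average, h1, Finset.sum_sub_distrib, ← Finset.mul_sum]
    field_simp
    ring
  simp_rw [herr, mul_pow, ENNReal.ofReal_mul (sq_nonneg (N : ℝ))] at hkey
  have hm : Measurable fun ω => average R X t ω - g (pingKnowledge R P X i t ω) :=
    ((Finset.measurable_sum _ fun l _ => h.measurable_current_value l t).const_mul _).sub
      (h.measurable_estimate hg i t)
  rw [lintegral_const_mul _ (hm.pow_const 2).ennreal_ofReal, hcard] at hkey
  have h2 : ENNReal.ofReal (((N : ℝ) - 1) / (N : ℝ) ^ 2 * σ ^ 2 * (1 - p ^ 2))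
      = ENNReal.ofReal (((N : ℝ) ^ 2)⁻¹) *
        ENNReal.ofReal (((N : ℝ) - 1) * ((1 - p ^ 2) * σ ^ 2)) := by
    rw [← ENNReal.ofReal_mul (by positivity)]
    congr 1
    ring
  rw [h2, mul_assoc]
  refine (mul_le_mul_right hkey _).trans_eq ?_
  rw [← mul_assoc, ← ENNReal.ofReal_mul (by positivity), inv_mul_cancel₀ (by positivity),
    ENNReal.ofReal_one, one_mul]

/-- Lower bound for the mean squared error of agent `i`, according to the time of the last Ping on
a grid of step `δ`. -/
lemma le_lintegral_error [IsProbabilityMeasure μ]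
    (h : IsPingSystem μ N rateR rateP σ ν R P X) (i : Fin N) {δ t : ℝ≥0} {K : ℕ}
    (hK : K * δ ≤ t) {g : Set (Info N) → ℝ} (hg : Measurable[knowledgeSigma N] g) :
    ENNReal.ofReal (((N : ℝ) - 1) / (N : ℝ) ^ 2 * σ ^ 2 * ∑ k ∈ Finset.range K,
        (1 - Real.exp (-(2 * rateR * δ)) ^ k) *
          (Real.exp (-(rateP * δ)) ^ k - Real.exp (-(rateP * δ)) ^ (k + 1))) ≤
      ∫⁻ ω, ENNReal.ofReal ((average R X t ω - g (pingKnowledge R P X i t ω)) ^ 2) ∂μ := by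
  have hN : 0 ≤ ((N : ℝ) - 1) / (N : ℝ) ^ 2 * σ ^ 2 := by
    have : (1 : ℝ) ≤ N := by exact_mod_cast i.pos
    have : 0 ≤ (N : ℝ) - 1 := by linarith
    positivity
  set B : ℕ → Set Ω := fun k => {ω | P i t ω - P i (t - k * δ) ω = 0} with hB
  have hq : Antitone fun k : ℕ => t - k * δ := fun k l hkl =>
    tsub_le_tsub_left (mul_le_mul_left (Nat.cast_le.2 hkl) δ) t
  have hBanti : Antitone B := by
    intro k l hkl ω hω
    have h1 : P i t ω - P i (t - l * δ) ω = 0 := hω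
    have h2 : P i (t - l * δ) ω ≤ P i (t - k * δ) ω := (h.ping_clock i).mono ω (hq hkl)
    change P i t ω - P i (t - k * δ) ω = 0
    omega
  have hBP : ∀ k, MeasurableSet[familySigma P] (B k) := fun k =>
    ((measurable_familySigma P i t).sub (measurable_familySigma P i _)) (measurableSet_singleton 0)
  have hsub : ∀ k ≤ K, t - (t - k * δ) = k * δ := fun k hk =>
    tsub_tsub_cancel_of_le ((mul_le_mul_left (Nat.cast_le.2 hk) δ).trans hK)
  have hBμ : ∀ k ≤ K, μ (B k) = ENNReal.ofReal (Real.exp (-(rateP * δ)) ^ k) := by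
    intro k hk
    rw [(h.ping_clock i).measure_eq tsub_le_self, hsub k hk, ← Real.exp_nat_mul]
    congr 2
    push_cast
    ring
  -- The last Ping of `i` falls in `(t - (k+1)δ, t - kδ]`. The bound is applied with `q = t - kδ`,
  -- the end of the cell, after which `i` certainly receives nothing.
  set A : ℕ → Set Ω := fun k => B k \ B (k + 1) with hA
  have hAP : ∀ k, MeasurableSet[familySigma P] (A k) := fun k => (hBP k).diff (hBP (k + 1))
  have hAm : ∀ k, MeasurableSet (A k) := fun k => h.ping_le _ (hAP k)
  have hAdisj : Pairwise (Function.onFun Disjoint A) := by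
    refine (pairwise_disjoint_on A).2 fun k l hkl => Set.disjoint_left.2 fun ω hk hl => ?_
    exact hk.2 (hBanti hkl hl.1)
  have hAμ : ∀ k < K, μ (A k) = ENNReal.ofReal
      (Real.exp (-(rateP * δ)) ^ k - Real.exp (-(rateP * δ)) ^ (k + 1)) := by
    intro k hk
    rw [measure_sdiff (hBanti (Nat.le_succ k)) (h.ping_le _ (hBP _)).nullMeasurableSet
      (measure_ne_top _ _), hBμ k hk.le, hBμ (k + 1) hk, ENNReal.ofReal_sub _ (by positivity)]
  have hexp1 : Real.exp (-(rateP * δ)) ≤ 1 := by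
    rw [Real.exp_le_one_iff, neg_nonpos]
    positivity
  have hexp2 : Real.exp (-(2 * rateR * δ)) ≤ 1 := by
    rw [Real.exp_le_one_iff, neg_nonpos]
    positivity
  have hk1 : ∀ k : ℕ, 0 ≤ 1 - Real.exp (-(2 * rateR * δ)) ^ k := fun k =>
    sub_nonneg.2 (pow_le_one₀ (Real.exp_pos _).le hexp2)
  have hk2 : ∀ k : ℕ, 0 ≤ Real.exp (-(rateP * δ)) ^ k - Real.exp (-(rateP * δ)) ^ (k + 1) :=
    fun k => sub_nonneg.2 (pow_le_pow_of_le_one (Real.exp_pos _).le hexp1 (Nat.le_succ k))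
  calc _ = ∑ k ∈ Finset.range K, ENNReal.ofReal (((N : ℝ) - 1) / (N : ℝ) ^ 2 * σ ^ 2 *
          (1 - Real.exp (-(2 * rateR * δ)) ^ k)) * μ (A k) := by
        rw [Finset.mul_sum, ENNReal.ofReal_sum_of_nonneg fun k _ =>
          mul_nonneg hN (mul_nonneg (hk1 k) (hk2 k))]
        refine Finset.sum_congr rfl fun k hk => ?_
        rw [hAμ k (Finset.mem_range.1 hk), ← mul_assoc,
          ENNReal.ofReal_mul (mul_nonneg hN (hk1 k))]
    _ ≤ ∑ k ∈ Finset.range K, ∫⁻ ω in A k,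
          ENNReal.ofReal ((average R X t ω - g (pingKnowledge R P X i t ω)) ^ 2) ∂μ := by
        refine Finset.sum_le_sum fun k hk => ?_
        have hp : Real.exp (-(rateR * (k * δ))) =
            Real.exp (-(rateR * (t - (t - k * δ)) : ℝ≥0)) := by
          rw [hsub k (Finset.mem_range.1 hk).le]
          push_cast
          rfl
        have hp2 : Real.exp (-(rateR * (k * δ))) ^ 2 = Real.exp (-(2 * rateR * δ)) ^ k := by
          rw [← Real.exp_nat_mul, ← Real.exp_nat_mul]
          congr 1
          push_cast
          ring
        rw [← hp2]
        refine h.le_setLIntegral_error tsub_le_self (hAP k) (fun ω hω => ?_) hg hp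
        have h1 : P i t ω - P i (t - k * δ) ω = 0 := hω.1
        have h2 : P i (t - k * δ) ω ≤ P i t ω := (h.ping_clock i).mono ω tsub_le_self
        omega
    _ = ∫⁻ ω in ⋃ k ∈ Finset.range K, A k,
          ENNReal.ofReal ((average R X t ω - g (pingKnowledge R P X i t ω)) ^ 2) ∂μ :=
        (lintegral_biUnion_finset (fun k _ l _ hkl => hAdisj hkl) (fun k _ => hAm k) _).symm
    _ ≤ _ := setLIntegral_le_lintegral _ _

lemma le_lintegral_squaredError [IsProbabilityMeasure μ]
    (h : IsPingSystem μ N rateR rateP σ ν R P X) (hN : 1 ≤ N) {δ t : ℝ≥0} {K : ℕ}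
    (hK : K * δ ≤ t) {y : Fin N → ℝ≥0 → Set (Info N) → ℝ}
    (hy : ∀ i t, Measurable[knowledgeSigma N] (y i t)) :
    ENNReal.ofReal (((N : ℝ) - 1) / (N : ℝ) ^ 2 * σ ^ 2 * ∑ k ∈ Finset.range K,
        (1 - Real.exp (-(2 * rateR * δ)) ^ k) *
          (Real.exp (-(rateP * δ)) ^ k - Real.exp (-(rateP * δ)) ^ (k + 1))) ≤
      ∫⁻ ω, ENNReal.ofReal (squaredError R P X y t ω) ∂μ := by
  have hm : ∀ i, Measurable fun ω => average R X t ω - y i t (pingKnowledge R P X i t ω) :=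
    fun i => ((Finset.measurable_sum _ fun l _ => h.measurable_current_value l t).const_mul _).sub
      (h.measurable_estimate (hy i t) i t)
  have hN' : (N : ℝ) ≠ 0 := by positivity
  simp_rw [squaredError, ENNReal.ofReal_mul (one_div_nonneg.2 (Nat.cast_nonneg (α := ℝ) N)),
    ENNReal.ofReal_sum_of_nonneg fun i _ => sq_nonneg _]
  rw [lintegral_const_mul _ (Finset.measurable_sum _ fun i _ =>
      ((hm i).pow_const 2).ennreal_ofReal),
    lintegral_finsetSum _ fun i _ => ((hm i).pow_const 2).ennreal_ofReal]
  refine le_trans ?_ (mul_le_mul_right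
    (Finset.sum_le_sum fun i _ => h.le_lintegral_error i hK (hy i t)) _)
  rw [Finset.sum_const, Finset.card_univ, Fintype.card_fin, nsmul_eq_mul, ← mul_assoc,
    ← ENNReal.ofReal_natCast, ← ENNReal.ofReal_mul (by positivity), one_div,
    inv_mul_cancel₀ hN', ENNReal.ofReal_one, one_mul]

end IsPingSystem

end Bound

/-! ### Limits in the number of cells and in the grid step -/

/-- The mean of `1 - z ^ k` under the geometric law of the rounded age, as a difference of two
geometric series. -/
lemma tendsto_sum_geometric_gap {a z : ℝ} (ha0 : 0 ≤ a) (ha1 : a < 1) (hz0 : 0 ≤ z)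
    (hz1 : z ≤ 1) : Tendsto (fun K => ∑ k ∈ Finset.range K, (1 - z ^ k) * (a ^ k - a ^ (k + 1)))
      atTop (nhds (1 - (1 - a) / (1 - z * a))) := by
  have hza : z * a < 1 := (mul_le_of_le_one_left ha0 hz1).trans_lt ha1
  have h1 := (hasSum_geometric_of_lt_one ha0 ha1).mul_left (1 - a)
  have h2 := (hasSum_geometric_of_lt_one (mul_nonneg hz0 ha0) hza).mul_left (1 - a)
  have h3 := (h1.sub h2).tendsto_sum_nat
  rw [mul_inv_cancel₀ (by linarith), ← div_eq_mul_inv] at h3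
  refine h3.congr fun K => Finset.sum_congr rfl fun k _ => ?_
  rw [mul_pow]
  ring

lemma tendsto_one_sub_exp_div (α : ℝ) {β : ℝ} (hβ : β ≠ 0) :
    Tendsto (fun δ : ℝ => (1 - Real.exp (-(α * δ))) / (1 - Real.exp (-(β * δ))))
      (nhdsWithin 0 (Set.Ioi 0)) (nhds (α / β)) := by
  have key : ∀ c : ℝ, Tendsto (fun δ : ℝ => δ⁻¹ * (1 - Real.exp (-(c * δ))))
      (nhdsWithin 0 (Set.Ioi 0)) (nhds c) := by
    intro c
    have h1 : HasDerivAt (fun δ : ℝ => 1 - Real.exp (-(c * δ))) c 0 := by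
      have := ((((hasDerivAt_id (0 : ℝ)).const_mul c).neg).exp).const_sub 1
      simpa using this
    have h2 := h1.tendsto_slope_zero_right
    simpa using h2
  refine ((key α).div (key β) hβ).congr' ?_
  filter_upwards [self_mem_nhdsWithin] with δ hδ
  have : δ⁻¹ ≠ 0 := inv_ne_zero (ne_of_gt hδ)
  exact mul_div_mul_left _ _ this

end PingModel
end

theorem mainTheorem11 {Ω : Type*} [MeasurableSpace Ω] (μ : Measure Ω) [IsProbabilityMeasure μ]
    (N : ℕ) (hN : 1 ≤ N) (rateR rateP : ℝ≥0) (hR : 0 < rateR) (hP : 0 < rateP)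
    (σ : ℝ) (ν : Measure ℝ) (R P : Fin N → ℝ≥0 → Ω → ℕ) (X : Fin N → ℕ → Ω → ℝ)
    (hsys : PingModel.IsPingSystem μ N rateR rateP σ ν R P X)
    (y : Fin N → ℝ≥0 → Set (PingModel.Info N) → ℝ)
    (hy : ∀ i t, Measurable[PingModel.knowledgeSigma N] (y i t)) :
    ENNReal.ofReal (((N : ℝ) - 1) / (N : ℝ) ^ 2 *
        (1 / (1 + (rateP : ℝ) / (2 * (rateR : ℝ)))) * σ ^ 2) ≤
      liminf (fun t : ℝ≥0 => ∫⁻ ω, ENNReal.ofReal (PingModel.squaredError R P X y t ω) ∂μ)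
        atTop := by
  have hR' : (0 : ℝ) < rateR := hR
  have hP' : (0 : ℝ) < rateP := hP
  set c : ℝ := ((N : ℝ) - 1) / (N : ℝ) ^ 2 * σ ^ 2 with hc
  have hstep : ∀ δ : ℝ, 0 < δ → ENNReal.ofReal (c * (1 - (1 - Real.exp (-(rateP * δ))) /
      (1 - Real.exp (-((2 * rateR + rateP) * δ))))) ≤
      liminf (fun t : ℝ≥0 => ∫⁻ ω, ENNReal.ofReal (PingModel.squaredError R P X y t ω) ∂μ)
        atTop := by
    intro δ hδ
    lift δ to ℝ≥0 using hδ.le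
    have hlim := PingModel.tendsto_sum_geometric_gap (Real.exp_pos (-(rateP * δ))).le
      (Real.exp_lt_one_iff.2 (neg_neg_of_pos (mul_pos hP' hδ)))
      (Real.exp_pos (-(2 * rateR * δ))).le
      (Real.exp_le_one_iff.2 (neg_nonpos.2 (by positivity)))
    rw [← Real.exp_add, show -(2 * (rateR : ℝ) * δ) + -(rateP * δ)
      = -((2 * rateR + rateP) * δ) by ring] at hlim
    -- For fixed `δ` and `K` the bound holds for all `t ≥ K δ`, so it passes to the liminf before `K
    -- → ∞`.
    refine le_of_tendsto' (ENNReal.tendsto_ofReal (hlim.const_mul c)) fun K => ?_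
    refine le_liminf_of_le (by isBoundedDefault) ?_
    filter_upwards [eventually_ge_atTop (K * δ)] with t ht
    exact hsys.le_lintegral_squaredError hN ht hy
  have hlim := ENNReal.tendsto_ofReal (((PingModel.tendsto_one_sub_exp_div (rateP : ℝ)
    (β := 2 * rateR + rateP) (by positivity)).const_sub 1).const_mul c)
  have hval : ((N : ℝ) - 1) / (N : ℝ) ^ 2 * (1 / (1 + (rateP : ℝ) / (2 * (rateR : ℝ)))) * σ ^ 2
      = c * (1 - rateP / (2 * rateR + rateP)) := by
    have : 1 / (1 + (rateP : ℝ) / (2 * (rateR : ℝ))) = 1 - rateP / (2 * rateR + rateP) := by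
      field_simp
      ring
    rw [this, hc]
    ring
  rw [hval]
  -- The liminf does not involve `δ`, so `δ → 0+` can be taken in the lower bound alone.
  refine le_of_tendsto hlim ?_
  filter_upwards [self_mem_nhdsWithin] with δ hδ using hstep δ hδ
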